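/- **Linear quantum Landau damping.** Let $\mathbb T^3=\mathbb R^3/\mathbb Z^3$ and write $\hat f(k)=\int_{\mathbb T^3}f(x)e^{-2\pi i k\cdot x}\,dx$ and $\hat f(k,\eta)=\int_{\mathbb R^3}\int_{\mathbb T^3}f(x,v)e^{-2\pi i k\cdot x}e^{-2\pi i\eta\cdot v}\,dx\,dv$ for $k\in\mathbb Z^3$, $\eta\in\mathbb R^3$; $\hat f(l,v)$ denotes the Fourier coefficient in $x$ only. For $\lambda,\mu>0$ and $\tau\in\mathbb R$ put $$\|g\|_{\mathcal C^{\lambda;1}}=\sum_{n\in\mathbb N_0^3}\frac{\lambda^{|n|}}{n!}\|\nabla_v^n g\|_{L^1(\mathbb R^3)},\qquad \|f\|_{\mathcal Z^{\lambda,\mu;1}_\tau}=\sum_{l\in\mathbb Z^3}\sum_{n\in\mathbb N_0^3}\frac{\lambda^{|n|}}{n!}e^{2\pi\mu|l|}\big\|(\nabla_v+2\pi i\tau l)^n\hat f(l,\cdot)\big\|_{L^1(\mathbb R^3)},$$ for $g=g(v)$ and $f=f(x,v)$ (the norms are $+\infty$ if the functions of $v$ involved are not smooth), and $\mathcal Z^{\lambda,\mu;1}=\mathcal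 Z^{\lambda,\mu;1}_0$. For $\hbar,m>0$, $e\in\mathbb R$, an integrable $W:\mathbb T^3\to\mathbb R$ and a velocity profile $w^0_\hbar=w^0_\hbar(v)$, consider classical solutions $w_\hbar(t,x,v)$, $t\ge0$, of the linearized Wigner equation $$\partial_tw_\hbar+v\cdot\nabla_xw_\hbar+\frac em\Theta_\hbar[\phi]w^0_\hbar=0,\qquad \phi=W*n_\hbar,\qquad n_\hbar(t,x)=\int_{\mathbb R^3}w_\hbar(t,x,v)\,dv,\qquad w_\hbar(0,\cdot,\cdot)=w_{\hbar I},$$ $$(\Theta_\hbar[\phi]w^0_\hbar)(t,x,v)=\frac{im}{(2\pi)^3}\int_{\mathbb R^3}\int_{\mathbb R^3}\frac{\phi(t,x+\frac{\hbar}{2m}\eta)-\phi(t,x-\frac{\hbar}{2m}\eta)}{\hbar}\,w^0_\hbar(v')e^{i(v-v')\cdot\eta}\,dv'\,d\eta.$$ Here "classical solution" means: for each $v$ the function $(t,x)\mapsto w_\hbar(t,x,v)$ is continuous on $[0,\infty)\times\mathbb T^3$ and $C^1$ on $(0,\infty)\times\mathbb T^3$, the equation holds for all $t>0$, and $w_\hbar(t)\in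 L^1(\mathbb T^3\times\mathbb R^3)$ for all $t\ge 0$ with norm bounded for $t$ in bounded intervals. There is a function $C(C_0,\delta_0)$ such that the following holds. Let $e\in\mathbb R$, $m>0$, $\gamma\ge1$, $\bar\lambda>\lambda>0$, $\bar\mu>\mu>0$, $C_0>0$. Then every sufficiently small $\delta_0>0$ (with a threshold depending only on these constants) has the following property. Let $\hbar>0$ and let $b=b(t,\tau)>0$ be a function defined for $0<\tau\le t$. Assume 1. $\hat W(0)=0$ and $|\hat W(k)|\le \frac1{1+|k|^\gamma}$ for all $k\in\mathbb Z^3$; 2. $\|w^0_\hbar\|_{\mathcal C^{\lambda;1}}\le C_0$; 3. $\|w_{\hbar I}\|_{\mathcal Z^{\lambda,\mu;1}}\le\delta_0$; 4. (quantum stability condition) for every $l\in\mathbb Z^3\setminus\{0\}$, with the wave vector $\kappa=2\pi l$, the function $$\delta w^0_\hbar(x,v)=\frac{w^0_\hbar\big(v-\frac{\hbar}{2m}\kappa\big)-w^0_\hbar\big(v+\frac{\hbar}{2m}\kappa\big)}{\frac{\hbar}{m}|\kappa|}$$ satisfies, for all $0<\tau\le t$ and with $b=b(t,\tau)$, $$\Big\|\int_{\mathbb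 T^3}\delta w^0_\hbar(x,\cdot)\,dx\Big\|_{\mathcal C^{\bar\lambda(1+b);1}}\le\delta_0,\qquad \|\delta w^0_\hbar\|_{\mathcal Z^{\bar\lambda(1+b),\bar\mu;1}_{\tau-\frac{bt}{1+b}}}\le\delta_0 .$$ Let $w_{\hbar}$ be a classical solution, and let $\bar w_{\hbar I}(v)=\int_{\mathbb T^3}w_{\hbar I}(x,v)\,dx$ and $n_{\hbar I}=\int_{\mathbb T^3}\int_{\mathbb R^3}w_{\hbar I}(x,v)\,dv\,dx$, regarded as functions that do not depend on $x$ (so that their Fourier coefficients with $k\ne0$ vanish). Then for all $t\ge0$, $k\in\mathbb Z^3$ and $\eta\in\mathbb R^3$ $$|\hat w_\hbar(t,k,\eta)-\hat{\bar w}_{\hbar I}(k,\eta)|\le C(C_0,\delta_0)\,e^{-2\pi\lambda|\eta+kt|}e^{-2\pi\mu|k|},$$ $$|\hat n_\hbar(t,k)-\hat n_{\hbar I}(k)|\le C(C_0,\delta_0)\,e^{-2\pi(\lambda t+\mu)|k|},$$ $$|\hat\phi(t,k)|\le C(C_0,\delta_0)\,e^{-2\pi\lambda|k|t}e^{-2\pi\mu|k|}.$$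 -/

import Mathlib

open scoped ENNReal ContDiff RealInnerProductSpace FourierTransform
open MeasureTheory

noncomputable section

namespace QuantumLandau

/-- Velocity space `ℝ³` with the Euclidean norm. -/
abbrev V3 : Type := EuclideanSpace ℝ (Fin 3)

/-- The torus `𝕋³ = ℝ³ / ℤ³`, with its Haar probability measure as volume. -/
abbrev T3 : Type := UnitAddTorus (Fin 3)

/-- The quotient map `ℝ³ → 𝕋³`. -/
def proj (x : V3) : T3 := fun i => ((x i : ℝ) : UnitAddCircle)

/-- A lattice vector `k ∈ ℤ³` as an element of `ℝ³`; `‖vec k‖` is its Euclidean length `|k|`. -/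
def vec (k : Fin 3 → ℤ) : V3 := WithLp.toLp 2 (fun i => (k i : ℝ))

/-! ### Fourier transforms, with the kernels `e^{-2πi k·x}` and `e^{-2πi η·v}` -/

/-- `f̂(k) = ∫_{𝕋³} f(x) e^{-2πi k·x} dx` for `f = f(x)`. -/
def fourierX (f : T3 → ℝ) (k : Fin 3 → ℤ) : ℂ :=
  UnitAddTorus.mFourierCoeff (fun x => (f x : ℂ)) k

/-- `f̂(k, η) = ∫_{ℝ³} ∫_{𝕋³} f(x,v) e^{-2πi k·x} e^{-2πi η·v} dx dv` for `f = f(x,v)`. -/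
def fourierXV (f : T3 → V3 → ℝ) (k : Fin 3 → ℤ) (η : V3) : ℂ :=
  𝓕 (fun v : V3 => fourierX (fun x => f x v) k) η

/-! ### Analytic norms -/

/-- The `i`-th component of the operator `∇_v + i a`, for `a ∈ ℝ³`. -/
def shiftedDeriv (a : V3) (i : Fin 3) (g : V3 → ℂ) : V3 → ℂ := fun v =>
  fderiv ℝ g v (EuclideanSpace.single i 1) + Complex.I * ((a i : ℝ) : ℂ) * g v

/-- `(∇_v + i a)ⁿ g` for a multi-index `n ∈ ℕ₀³`. -/
def shiftedDerivMulti (a : V3) (n : Fin 3 → ℕ) (g : V3 → ℂ) : V3 → ℂ :=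
  (shiftedDeriv a 0)^[n 0] ((shiftedDeriv a 1)^[n 1] ((shiftedDeriv a 2)^[n 2] g))

open Classical in
/-- `∑_{n ∈ ℕ₀³} (λⁿ / n!) ‖(∇_v + i a)ⁿ g‖_{L^p(ℝ³)}`, with the value `∞` if `g` is not smooth. -/
def shiftedNorm (lam : ℝ) (p : ℝ≥0∞) (a : V3) (g : V3 → ℂ) : ℝ≥0∞ :=
  if ContDiff ℝ ∞ g then
    ∑' n : Fin 3 → ℕ,
      ENNReal.ofReal (lam ^ (∑ i, n i) / ∏ i, ((n i).factorial : ℝ)) *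
        eLpNorm (shiftedDerivMulti a n g) p volume
  else ⊤

/-- The norm of `𝓒^{λ;p}` for functions of `v`: `∑_n (λⁿ / n!) ‖∇_vⁿ g‖_{L^p}`. -/
def normC (lam : ℝ) (p : ℝ≥0∞) (g : V3 → ℝ) : ℝ≥0∞ :=
  shiftedNorm lam p 0 (fun v => (g v : ℂ))

/-- The time-shifted hybrid norm of `𝓩^{λ,μ;p}_τ` for functions of `(x,v)`:
`∑_{l ∈ ℤ³} ∑_n (λⁿ / n!) e^{2πμ|l|} ‖(∇_v + 2πiτ l)ⁿ f̂(l,·)‖_{L^p}`, where `f̂(l,v)` is the Fourier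
coefficient in `x`. The norm of `𝓩^{λ,μ;p}` is the case `τ = 0`. -/
def normZ (lam mu : ℝ) (p : ℝ≥0∞) (τ : ℝ) (f : T3 → V3 → ℝ) : ℝ≥0∞ :=
  ∑' l : Fin 3 → ℤ,
    ENNReal.ofReal (Real.exp (2 * Real.pi * mu * ‖vec l‖)) *
      shiftedNorm lam p ((2 * Real.pi * τ) • vec l) (fun v => fourierX (fun x => f x v) l)

/-! ### The linearized Wigner equation -/

/-- The density `n(x) = ∫ f(x,v) dv`. -/
def density (f : T3 → V3 → ℝ) (x : T3) : ℝ := ∫ v : V3, f x v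

/-- The potential `φ = W * n` on the torus. -/
def potential (W n : T3 → ℝ) (x : T3) : ℝ := ∫ y : T3, W y * n (x - y)

/-- The pseudo-differential operator
`(Θ_ħ[φ] f)(x,v) = i m / (2π)³ ∫ ∫ (φ(x + ħη/2m) - φ(x - ħη/2m)) / ħ · f(x,v') e^{i(v-v')·η} dv' dη`. -/
def theta (hbar m : ℝ) (φ : T3 → ℝ) (f : T3 → V3 → ℝ) (x : T3) (v : V3) : ℂ :=
  Complex.I * (m : ℂ) / (2 * (Real.pi : ℂ)) ^ 3 *
    ∫ η : V3, ∫ v' : V3,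
      (((φ (x + proj ((hbar / (2 * m)) • η)) - φ (x - proj ((hbar / (2 * m)) • η))) / hbar : ℝ) : ℂ)
        * (f x v' : ℂ) * Complex.exp (Complex.I * ((⟪v - v', η⟫ : ℝ) : ℂ))

/-- `w = w(t,x,v)`, `t ≥ 0`, is a classical solution of
`∂_t w + v·∇_x w + (e/m) Θ_ħ[φ] w⁰ = 0`, `φ = W * ∫ w dv`, `w(0,·,·) = w_I`, linearized about the
velocity profile `w⁰ = w⁰(v)`. Functions of `x ∈ 𝕋³` are differentiated through their periodic
lifts to `ℝ³`. -/
structure IsSolution (hbar m e : ℝ) (W : T3 → ℝ) (w0 : V3 → ℝ) (wI : T3 → V3 → ℝ)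
    (w : ℝ → T3 → V3 → ℝ) : Prop where
  integrable : ∀ t : ℝ, 0 ≤ t → Integrable (fun p : T3 × V3 => w t p.1 p.2)
  locally_bounded : ∀ T : ℝ, ∃ M : ℝ, ∀ t : ℝ, 0 ≤ t → t ≤ T →
    ∫ p : T3 × V3, |w t p.1 p.2| ≤ M
  continuousOn : ∀ v : V3,
    ContinuousOn (fun q : ℝ × V3 => w q.1 (proj q.2) v) (Set.Ici 0 ×ˢ Set.univ)
  contDiffOn : ∀ v : V3,
    ContDiffOn ℝ 1 (fun q : ℝ × V3 => w q.1 (proj q.2) v) (Set.Ioi 0 ×ˢ Set.univ)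
  equation : ∀ t : ℝ, 0 < t → ∀ x v : V3,
    ((deriv (fun s : ℝ => w s (proj x) v) t
        + fderiv ℝ (fun y : V3 => w t (proj y) v) x v : ℝ) : ℂ)
      + ((e / m : ℝ) : ℂ)
        * theta hbar m (potential W (density (w t))) (fun _ v' => w0 v') (proj x) v = 0
  initial : ∀ (x : T3) (v : V3), w 0 x v = wI x v

/-! ### The quantum stability condition -/

/-- The finite difference
`δ_l f(x,v) = (f(x, v - ħκ/2m) - f(x, v + ħκ/2m)) / (ħ|κ|/m)` for the wave vector `κ = 2πl` of the
Fourier mode `e^{2πi l·x}`. -/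
def deltaW (hbar m : ℝ) (l : Fin 3 → ℤ) (f : T3 → V3 → ℝ) (x : T3) (v : V3) : ℝ :=
  (f x (v - (hbar / (2 * m)) • ((2 * Real.pi) • vec l))
      - f x (v + (hbar / (2 * m)) • ((2 * Real.pi) • vec l)))
    / (hbar / m * ‖(2 * Real.pi) • vec l‖)

/-- The quantum stability condition with constant `δ₀`, for a positive function `b = b(t,τ)`. -/
def StabilityCondition (hbar m lamb mub δ₀ : ℝ) (b : ℝ → ℝ → ℝ) (w0 : V3 → ℝ) : Prop :=
  ∀ l : Fin 3 → ℤ, l ≠ 0 → ∀ t τ : ℝ, 0 < τ → τ ≤ t →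
    normC (lamb * (1 + b t τ)) 1 (fun v => ∫ x : T3, deltaW hbar m l (fun _ v' => w0 v') x v)
        ≤ ENNReal.ofReal δ₀ ∧
    normZ (lamb * (1 + b t τ)) mub 1 (τ - b t τ * t / (1 + b t τ))
        (deltaW hbar m l (fun _ v' => w0 v')) ≤ ENNReal.ofReal δ₀

/-! ### The asymptotic states -/

/-- The spatial mean `∫_{𝕋³} f(x,v) dx`, as an `x`-independent function on phase space. -/
def spatialMean (f : T3 → V3 → ℝ) : T3 → V3 → ℝ := fun _ v => ∫ x : T3, f x v

/-- The total mass `∫_{𝕋³} ∫_{ℝ³} f(x,v) dv dx`, as a constant function on the torus. -/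
def meanDensity (f : T3 → V3 → ℝ) : T3 → ℝ := fun _ => ∫ x : T3, ∫ v : V3, f x v

end QuantumLandau

end

open QuantumLandau

/-!
Along the free flow `x ↦ x + sv`, the Fourier mode `k` of a solution satisfies a Duhamel equation
`ŵ(t, k, ξ - tk) = ŵ_I(k, ξ) + ∫₀ᵗ (ie/ħ) φ̂(s, k) F(ξ - sk) ds`, where `F` is the Fourier transform
of the increment `w⁰(v - ħκ/2m) - w⁰(v + ħκ/2m)`, `κ = 2πk`. By the stability condition
`|F(ξ)| ≤ δ₀ (ħ|κ|/m) e^{-2πλ̄|ξ|}`. The factor `ħ` cancels the one in front of the integral, and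
since `λ̄ > λ` the integral over `s` gains a factor `1 / (π(λ̄ - λ)|k|)`, which absorbs `|κ|`.
Hence, for small `δ₀`, the equation contracts by `1/2` in the norm weighted with
`e^{2πλ|ξ|} e^{2πμ|k|}`; as `φ̂(s, k)` only involves the mode at `ξ = sk`, the decay of the density
closes on itself and then yields that of the full mode.
-/

namespace QuantumLandau

/-! ### Fourier transforms of analytic functions -/

section Fourier

variable {V : Type*} [NormedAddCommGroup V] [InnerProductSpace ℝ V] [FiniteDimensional ℝ V]
  [MeasurableSpace V] [BorelSpace V]

theorem fourier_eq_integral_mul (g : V → ℂ) (η : V) : 𝓕 g η = ∫ v, (𝐞 (-⟪v, η⟫) : ℂ) * g v :=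
  rfl

theorem integrable_fourierChar_mul {α : Type*} [MeasurableSpace α] {μ : Measure α} {g : α → ℂ}
    (hg : Integrable g μ) {u : α → ℝ} (hu : Measurable u) :
    Integrable (fun x => (𝐞 (u x) : ℂ) * g x) μ :=
  hg.bdd_mul (c := 1)
    (Real.differentiable_fourierChar.continuous.measurable.comp hu).aestronglyMeasurable
    (.of_forall fun _ => (Circle.norm_coe _).le)

theorem enorm_fourier_le_eLpNorm_one (g : V → ℂ) (η : V) : ‖𝓕 g η‖ₑ ≤ eLpNorm g 1 volume := by
  rw [eLpNorm_one_eq_lintegral_enorm, Real.fourier_eq]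
  refine (enorm_integral_le_lintegral_enorm _).trans_eq (lintegral_congr fun v => ?_)
  rw [← ofReal_norm, Circle.norm_smul, ofReal_norm]

theorem continuous_fourier {g : V → ℂ} (hg : Integrable g) : Continuous (𝓕 g) :=
  VectorFourier.fourierIntegral_continuous Real.continuous_fourierChar (innerSL ℝ).continuous₂ hg

theorem fourier_fderiv_apply {g : V → ℂ} (hg : Differentiable ℝ g) (hgi : Integrable g) {u : V}
    (hgi' : Integrable fun v => fderiv ℝ g v u) (η : V) :
    𝓕 (fun v => fderiv ℝ g v u) η = 2 * Real.pi * Complex.I * ⟪u, η⟫ * 𝓕 g η := by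
  have hchar (v : V) : fderiv ℝ (fun v => (𝐞 (-⟪v, η⟫) : ℂ)) v u
      = -2 * Real.pi * Complex.I * ⟪u, η⟫ * (𝐞 (-⟪v, η⟫) : ℂ) :=
    Real.fderiv_fourierChar_neg_bilinear_left_apply (innerSL ℝ) v u η
  have hmeas : Measurable fun v : V => -⟪v, η⟫ := by fun_prop
  have hparts := integral_mul_fderiv_eq_neg_fderiv_mul_of_integrable (μ := volume)
    (f := fun v => (𝐞 (-⟪v, η⟫) : ℂ)) (g := g) (v := u)
    (by simpa only [hchar, mul_assoc (_ * (⟪u, η⟫ : ℂ))] using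
      (integrable_fourierChar_mul hgi hmeas).const_mul _)
    (integrable_fourierChar_mul hgi' hmeas) (integrable_fourierChar_mul hgi hmeas)
    (fun v _ => Real.differentiable_fourierChar_neg_bilinear_left (innerSL ℝ) η v)
    (fun v _ => hg v)
  rw [fourier_eq_integral_mul, hparts, fourier_eq_integral_mul, ← integral_const_mul,
    ← integral_neg]
  exact integral_congr_ae (.of_forall fun v => by simp only [hchar]; ring)

end Fourier

section ShiftedDeriv

variable {a : V3} {i : Fin 3} {g : V3 → ℂ}

theorem contDiff_shiftedDeriv (a : V3) (i : Fin 3) (hg : ContDiff ℝ ∞ g) :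
    ContDiff ℝ ∞ (shiftedDeriv a i g) :=
  ((hg.fderiv_right (m := ∞) le_rfl).clm_apply contDiff_const).add (contDiff_const.mul hg)

theorem contDiff_iterate_shiftedDeriv (a : V3) (i : Fin 3) (hg : ContDiff ℝ ∞ g) (n : ℕ) :
    ContDiff ℝ ∞ ((shiftedDeriv a i)^[n] g) :=
  Function.Iterate.rec (ContDiff ℝ ∞) hg (fun _ => contDiff_shiftedDeriv a i) n

theorem contDiff_shiftedDerivMulti (a : V3) (hg : ContDiff ℝ ∞ g) (n : Fin 3 → ℕ) :
    ContDiff ℝ ∞ (shiftedDerivMulti a n g) :=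
  contDiff_iterate_shiftedDeriv a 0 (contDiff_iterate_shiftedDeriv a 1
    (contDiff_iterate_shiftedDeriv a 2 hg _) _) _

theorem fourier_shiftedDeriv (hg : Differentiable ℝ g) (hgi : Integrable g)
    (hgi' : Integrable (shiftedDeriv a i g)) (η : V3) :
    𝓕 (shiftedDeriv a i g) η = Complex.I * ((2 * Real.pi) • η + a) i * 𝓕 g η := by
  have hderiv : Integrable fun v => fderiv ℝ g v (EuclideanSpace.single i 1) := by
    refine (hgi'.sub (hgi.const_mul (Complex.I * (a i : ℂ)))).congr (.of_forall fun v => ?_)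
    simp [shiftedDeriv]
  have hsplit := VectorFourier.fourierIntegral_add (μ := (volume : Measure V3))
    Real.continuous_fourierChar (L := innerₗ V3) (innerSL ℝ).continuous₂ hderiv
    (hgi.const_mul (Complex.I * (a i : ℂ)))
  calc 𝓕 (shiftedDeriv a i g) η
      = 𝓕 (fun v => fderiv ℝ g v (EuclideanSpace.single i 1)) η
        + 𝓕 (fun v => Complex.I * (a i : ℂ) * g v) η := congrFun hsplit η
    _ = 2 * Real.pi * Complex.I * ⟪EuclideanSpace.single i (1 : ℝ), η⟫ * 𝓕 g η
        + Complex.I * (a i : ℂ) * 𝓕 g η := by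
      rw [fourier_fderiv_apply hg hgi hderiv]
      simp only [fourier_eq_integral_mul, mul_left_comm _ (Complex.I * (a i : ℂ)),
        integral_const_mul]
    _ = Complex.I * ((2 * Real.pi) • η + a) i * 𝓕 g η := by
      simp [EuclideanSpace.inner_single_left]
      ring

theorem fourier_iterate_shiftedDeriv (hg : ContDiff ℝ ∞ g)
    (hgi : ∀ n, Integrable ((shiftedDeriv a i)^[n] g)) (η : V3) (n : ℕ) :
    𝓕 ((shiftedDeriv a i)^[n] g) η = (Complex.I * ((2 * Real.pi) • η + a) i) ^ n * 𝓕 g η := by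
  induction n with
  | zero => simp
  | succ n ih =>
    have hsucc := hgi (n + 1)
    rw [Function.iterate_succ_apply'] at hsucc ⊢
    rw [fourier_shiftedDeriv
      ((contDiff_iterate_shiftedDeriv a i hg n).differentiable (by simp)) (hgi n) hsucc, ih]
    ring

theorem fourier_shiftedDerivMulti (hg : ContDiff ℝ ∞ g)
    (hgi : ∀ n, Integrable (shiftedDerivMulti a n g)) (η : V3) (n : Fin 3 → ℕ) :
    𝓕 (shiftedDerivMulti a n g) η
      = (∏ i, (Complex.I * ((2 * Real.pi) • η + a) i) ^ n i) * 𝓕 g η := by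
  have hg₂ := contDiff_iterate_shiftedDeriv a 2 hg (n 2)
  have hg₁ := contDiff_iterate_shiftedDeriv a 1 hg₂ (n 1)
  rw [shiftedDerivMulti, fourier_iterate_shiftedDeriv hg₁, fourier_iterate_shiftedDeriv hg₂,
    fourier_iterate_shiftedDeriv hg, Fin.prod_univ_three]
  · ring
  · exact fun j => by simpa [shiftedDerivMulti] using hgi ![0, 0, j]
  · exact fun j => by simpa [shiftedDerivMulti] using hgi ![0, j, n 2]
  · exact fun j => by simpa [shiftedDerivMulti] using hgi ![j, n 1, n 2]

theorem norm_fourier_shiftedDerivMulti (hg : ContDiff ℝ ∞ g)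
    (hgi : ∀ n, Integrable (shiftedDerivMulti a n g)) (η : V3) (n : Fin 3 → ℕ) :
    ‖𝓕 (shiftedDerivMulti a n g) η‖ = (∏ i, |((2 * Real.pi) • η + a) i| ^ n i) * ‖𝓕 g η‖ := by
  simp only [fourier_shiftedDerivMulti hg hgi, norm_mul, norm_prod, norm_pow, Complex.norm_I,
    one_mul, Complex.norm_real, Real.norm_eq_abs]

end ShiftedDeriv

section ExpSeries

variable {ι : Type*} [Fintype ι]

theorem ofReal_exp_sum_le_tsum {x : ι → ℝ} (hx : ∀ i, 0 ≤ x i) :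
    ENNReal.ofReal (Real.exp (∑ i, x i))
      ≤ ∑' n : ι → ℕ, ENNReal.ofReal (∏ i, x i ^ n i / ((n i).factorial : ℝ)) := by
  classical
  have hterm (n : ι → ℕ) : 0 ≤ ∏ i, x i ^ n i / ((n i).factorial : ℝ) :=
    Finset.prod_nonneg fun i _ => div_nonneg (pow_nonneg (hx i) _) (Nat.cast_nonneg _)
  have hlim : Filter.Tendsto
      (fun N => ∏ i, ∑ j ∈ Finset.range N, x i ^ j / (j.factorial : ℝ)) Filter.atTop
      (nhds (Real.exp (∑ i, x i))) := by
    rw [Real.exp_sum]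
    refine tendsto_finsetProd _ fun i _ => ?_
    rw [Real.exp_eq_exp_ℝ]
    exact (NormedSpace.expSeries_div_hasSum_exp (x i)).tendsto_sum_nat
  refine le_of_tendsto' ((ENNReal.continuous_ofReal.tendsto _).comp hlim) fun N => ?_
  rw [Function.comp_apply, Finset.prod_univ_sum,
    ENNReal.ofReal_sum_of_nonneg fun n _ => hterm n]
  exact ENNReal.sum_le_tsum _

theorem norm_le_sum_abs (x : EuclideanSpace ℝ ι) : ‖x‖ ≤ ∑ i, |x i| := by
  classical
  let b := EuclideanSpace.basisFun ι ℝ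
  calc ‖x‖ = ‖∑ i, b.repr x i • b i‖ := by rw [b.sum_repr]
    _ ≤ ∑ i, |x i| := (norm_sum_le _ _).trans_eq (by simp [b, norm_smul])

end ExpSeries

section ShiftedNorm

variable {lam : ℝ} {p : ℝ≥0∞} {a : V3} {g : V3 → ℂ}

theorem contDiff_of_shiftedNorm_ne_top (h : shiftedNorm lam p a g ≠ ⊤) : ContDiff ℝ ∞ g := by
  by_contra hg
  simp [shiftedNorm, hg] at h

theorem shiftedNorm_eq_tsum (hg : ContDiff ℝ ∞ g) :
    shiftedNorm lam p a g = ∑' n : Fin 3 → ℕ,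
      ENNReal.ofReal (lam ^ (∑ i, n i) / ∏ i, ((n i).factorial : ℝ)) *
        eLpNorm (shiftedDerivMulti a n g) p volume :=
  if_pos hg

theorem shiftedNorm_mono {lam' : ℝ} (hlam : 0 ≤ lam) (h : lam ≤ lam') :
    shiftedNorm lam p a g ≤ shiftedNorm lam' p a g := by
  by_cases hg : ContDiff ℝ ∞ g
  · rw [shiftedNorm_eq_tsum hg, shiftedNorm_eq_tsum hg]
    gcongr
  · simp [shiftedNorm, hg]

theorem integrable_shiftedDerivMulti (hlam : 0 < lam) (h : shiftedNorm lam 1 a g ≠ ⊤)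
    (n : Fin 3 → ℕ) : Integrable (shiftedDerivMulti a n g) := by
  have hg := contDiff_of_shiftedNorm_ne_top h
  rw [shiftedNorm_eq_tsum hg] at h
  have hcoeff : 0 < lam ^ (∑ i, n i) / ∏ i, ((n i).factorial : ℝ) := by positivity
  rw [← memLp_one_iff_integrable]
  exact ⟨(contDiff_shiftedDerivMulti a hg n).continuous.aestronglyMeasurable,
    ENNReal.lt_top_of_mul_ne_top_right (ENNReal.ne_top_of_tsum_ne_top h n)
      (ENNReal.ofReal_pos.2 hcoeff).ne'⟩

theorem integrable_of_shiftedNorm_ne_top (hlam : 0 < lam) (h : shiftedNorm lam 1 a g ≠ ⊤) :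
    Integrable g :=
  integrable_shiftedDerivMulti hlam h 0

theorem ofReal_exp_mul_enorm_fourier_le_shiftedNorm (hlam : 0 < lam) (a : V3) (g : V3 → ℂ)
    (η : V3) :
    ENNReal.ofReal (Real.exp (lam * ‖(2 * Real.pi) • η + a‖)) * ‖𝓕 g η‖ₑ
      ≤ shiftedNorm lam 1 a g := by
  obtain h | h := eq_or_ne (shiftedNorm lam 1 a g) ⊤
  · exact h ▸ le_top
  have hg := contDiff_of_shiftedNorm_ne_top h
  set ζ : V3 := (2 * Real.pi) • η + a
  calc ENNReal.ofReal (Real.exp (lam * ‖ζ‖)) * ‖𝓕 g η‖ₑ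
      ≤ ENNReal.ofReal (Real.exp (∑ i, lam * |ζ i|)) * ‖𝓕 g η‖ₑ := by
        rw [← Finset.mul_sum]
        gcongr
        exact norm_le_sum_abs ζ
    _ ≤ ∑' n : Fin 3 → ℕ,
          ENNReal.ofReal (∏ i, (lam * |ζ i|) ^ n i / ((n i).factorial : ℝ)) * ‖𝓕 g η‖ₑ := by
        rw [ENNReal.tsum_mul_right]
        gcongr
        exact ofReal_exp_sum_le_tsum fun i => by positivity
    _ = ∑' n : Fin 3 → ℕ, ENNReal.ofReal (lam ^ (∑ i, n i) / ∏ i, ((n i).factorial : ℝ))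
          * ‖𝓕 (shiftedDerivMulti a n g) η‖ₑ := by
        refine tsum_congr fun n => ?_
        simp only [← ofReal_norm, norm_fourier_shiftedDerivMulti hg
          (integrable_shiftedDerivMulti hlam h)]
        rw [← ENNReal.ofReal_mul (by positivity), ← ENNReal.ofReal_mul (by positivity),
          ← mul_assoc]
        simp only [Finset.prod_div_distrib, mul_pow, Finset.prod_mul_distrib,
          Finset.prod_pow_eq_pow_sum, div_mul_eq_mul_div, ζ]
    _ ≤ shiftedNorm lam 1 a g := by
        rw [shiftedNorm_eq_tsum hg]
        gcongr
        exact enorm_fourier_le_eLpNorm_one _ _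

theorem norm_fourier_le_of_shiftedNorm_le {M : ℝ} (hlam : 0 < lam) (hM : 0 ≤ M)
    (h : shiftedNorm lam 1 a g ≤ ENNReal.ofReal M) (η : V3) :
    ‖𝓕 g η‖ ≤ M * Real.exp (-(lam * ‖(2 * Real.pi) • η + a‖)) := by
  have hexp := (ofReal_exp_mul_enorm_fourier_le_shiftedNorm hlam a g η).trans h
  rw [← ofReal_norm, ← ENNReal.ofReal_mul (Real.exp_nonneg _),
    ENNReal.ofReal_le_ofReal_iff hM] at hexp
  rwa [Real.exp_neg, ← div_eq_mul_inv, le_div_iff₀' (Real.exp_pos _)]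

end ShiftedNorm

section FourierDecay

variable {V : Type*} [NormedAddCommGroup V] [NormedSpace ℝ V] [FiniteDimensional ℝ V]
  [Nontrivial V] [MeasurableSpace V] [BorelSpace V]

theorem integrable_exp_neg_mul_norm (μ : Measure V) [μ.IsAddHaarMeasure] {c : ℝ} (hc : 0 < c) :
    Integrable (fun x => Real.exp (-c * ‖x‖)) μ := by
  rw [integrable_fun_norm_addHaar μ (f := fun r => Real.exp (-c * r))]
  simpa using integrableOn_rpow_mul_exp_neg_mul_rpow
    (neg_one_lt_zero.trans_le (Nat.cast_nonneg (Module.finrank ℝ V - 1))) one_pos hc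

variable {lam M : ℝ}

theorem norm_fourier_le_of_normC_le (hlam : 0 < lam) (hM : 0 ≤ M) {g : V3 → ℝ}
    (h : normC lam 1 g ≤ ENNReal.ofReal M) (η : V3) :
    ‖𝓕 (fun v => (g v : ℂ)) η‖ ≤ M * Real.exp (-2 * Real.pi * lam * ‖η‖) := by
  refine (norm_fourier_le_of_shiftedNorm_le hlam hM h η).trans_eq ?_
  rw [add_zero, norm_smul, Real.norm_of_nonneg Real.two_pi_pos.le]
  ring_nf

theorem norm_fourierXV_le_of_normZ_le (hlam : 0 < lam) (hM : 0 ≤ M) {mu τ : ℝ}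
    {f : T3 → V3 → ℝ} (h : normZ lam mu 1 τ f ≤ ENNReal.ofReal M) (k : Fin 3 → ℤ) (η : V3) :
    ‖fourierXV f k η‖ ≤ M * (Real.exp (-2 * Real.pi * lam * ‖η + τ • vec k‖)
      * Real.exp (-2 * Real.pi * mu * ‖vec k‖)) := by
  have hmode : shiftedNorm lam 1 ((2 * Real.pi * τ) • vec k) (fun v => fourierX (fun x => f x v) k)
      ≤ ENNReal.ofReal (M * Real.exp (-2 * Real.pi * mu * ‖vec k‖)) := by
    have hexp := Real.exp_pos (2 * Real.pi * mu * ‖vec k‖)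
    rw [show -2 * Real.pi * mu * ‖vec k‖ = -(2 * Real.pi * mu * ‖vec k‖) by ring, Real.exp_neg,
      ← div_eq_mul_inv, ENNReal.ofReal_div_of_pos hexp,
      ENNReal.le_div_iff_mul_le (by simp [hexp]) (by simp), mul_comm]
    exact (ENNReal.le_tsum k).trans h
  refine (norm_fourier_le_of_shiftedNorm_le hlam (by positivity) hmode η).trans_eq ?_
  rw [mul_smul (2 * Real.pi), ← smul_add, norm_smul, Real.norm_of_nonneg Real.two_pi_pos.le,
    mul_assoc, mul_comm (Real.exp _)]
  ring_nf

end FourierDecay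

section FourierInvertible

variable {V : Type*} [NormedAddCommGroup V] [InnerProductSpace ℝ V] [FiniteDimensional ℝ V]
  [MeasurableSpace V] [BorelSpace V]

/-- A function to which the Fourier inversion theorem applies pointwise. -/
structure FourierInvertible (g : V → ℂ) : Prop where
  continuous : Continuous g
  integrable : Integrable g
  integrable_fourier : Integrable (𝓕 g)

theorem FourierInvertible.integral_fourierChar_mul_fourier {g : V → ℂ} (hg : FourierInvertible g)
    (v : V) : ∫ ξ, (𝐞 ⟪ξ, v⟫ : ℂ) * 𝓕 g ξ = g v := by
  rw [← congrFun (hg.continuous.fourierInv_fourier_eq hg.integrable hg.integrable_fourier) v,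
    Real.fourierInv_eq]
  rfl

theorem fourierInvertible_of_normC_ne_top {lam : ℝ} (hlam : 0 < lam) {g : V3 → ℝ}
    (h : normC lam 1 g ≠ ⊤) : FourierInvertible fun v => (g v : ℂ) where
  continuous := (contDiff_of_shiftedNorm_ne_top h).continuous
  integrable := integrable_of_shiftedNorm_ne_top hlam h
  integrable_fourier := by
    have hle : normC lam 1 g ≤ ENNReal.ofReal (normC lam 1 g).toReal := (ENNReal.ofReal_toReal h).ge
    refine ((integrable_exp_neg_mul_norm volume (c := 2 * Real.pi * lam) (by positivity)).const_mul
      (normC lam 1 g).toReal).mono'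
      (continuous_fourier (integrable_of_shiftedNorm_ne_top hlam h)).aestronglyMeasurable
      (.of_forall fun η => ?_)
    simpa only [neg_mul] using norm_fourier_le_of_normC_le hlam ENNReal.toReal_nonneg hle η

end FourierInvertible

/-! ### Fourier coefficients on the torus -/

section Torus

variable {d : Type*} [Fintype d]

theorem norm_mFourier_apply (k : d → ℤ) (x : UnitAddTorus d) : ‖UnitAddTorus.mFourier k x‖ = 1 := by
  simp only [UnitAddTorus.mFourier, fourier_apply, ContinuousMap.coe_mk, norm_prod, Circle.norm_coe,
    Finset.prod_const_one]

theorem mFourier_apply_add (k : d → ℤ) (x y : UnitAddTorus d) :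
    UnitAddTorus.mFourier k (x + y) = UnitAddTorus.mFourier k x * UnitAddTorus.mFourier k y := by
  simp [UnitAddTorus.mFourier, fourier_apply, Finset.prod_mul_distrib, AddCircle.toCircle_add]

theorem volume_unitAddCircle : (volume : Measure UnitAddCircle) = AddCircle.haarAddCircle := by
  simpa using AddCircle.volume_eq_smul_haarAddCircle (T := 1)

instance isProbabilityMeasure_volume_unitAddCircle :
    IsProbabilityMeasure (volume : Measure UnitAddCircle) :=
  volume_unitAddCircle ▸ inferInstance

theorem integrable_mFourier_fst_mul {Y : Type*} [MeasurableSpace Y] {ν : Measure Y} [SFinite ν]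
    {f : UnitAddTorus d × Y → ℂ} (hf : Integrable f (volume.prod ν)) (k : d → ℤ) :
    Integrable (fun p => UnitAddTorus.mFourier k p.1 * f p) (volume.prod ν) :=
  hf.bdd_mul (c := 1)
    ((UnitAddTorus.mFourier k).continuous.measurable.comp measurable_fst).aestronglyMeasurable
    (.of_forall fun _ => (norm_mFourier_apply k _).le)

end Torus

theorem fourierX_eq_integral (f : T3 → ℝ) (k : Fin 3 → ℤ) :
    fourierX f k = ∫ x, UnitAddTorus.mFourier (-k) x * (f x : ℂ) := by
  -- `mFourierCoeff` integrates against the product of the measures `AddCircle.haarAddCircle`.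
  have hvol (μ : Measure UnitAddCircle) (hμ : μ = volume) :
      ∫ x : T3, UnitAddTorus.mFourier (-k) x * (f x : ℂ) ∂(Measure.pi fun _ => μ)
        = ∫ x : T3, UnitAddTorus.mFourier (-k) x * (f x : ℂ) := by
    subst hμ
    rfl
  exact hvol _ volume_unitAddCircle.symm

theorem fourierX_zero_right (f : T3 → ℝ) : fourierX f 0 = ((∫ x, f x : ℝ) : ℂ) := by
  simp [fourierX_eq_integral, UnitAddTorus.mFourier_zero, integral_complex_ofReal]

theorem vec_zero : vec 0 = 0 := by
  ext i
  simp [vec]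

theorem vec_ne_zero {k : Fin 3 → ℤ} (hk : k ≠ 0) : vec k ≠ 0 := by
  contrapose! hk
  ext i
  simpa [vec] using congrArg (fun y : V3 => y i) hk

theorem inner_vec (y : V3) (k : Fin 3 → ℤ) : ⟪y, vec k⟫ = ∑ i, (k i : ℝ) * y i := by
  simp [vec, PiLp.inner_apply]

theorem mFourier_proj (k : Fin 3 → ℤ) (y : V3) :
    UnitAddTorus.mFourier k (proj y) = (𝐞 ⟪y, vec k⟫ : ℂ) := by
  simp only [UnitAddTorus.mFourier, proj, ContinuousMap.coe_mk, fourier_coe_apply,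
    Real.fourierChar_apply, inner_vec]
  rw [← Complex.exp_sum]
  push_cast
  rw [Finset.mul_sum, Finset.sum_mul]
  exact congrArg _ (Finset.sum_congr rfl fun i _ => by ring)

theorem mFourier_neg_proj (k : Fin 3 → ℤ) (y : V3) :
    UnitAddTorus.mFourier (-k) (proj y) = (𝐞 (-⟪y, vec k⟫) : ℂ) := by
  rw [mFourier_proj, inner_vec, inner_vec]
  simp

theorem isOpenQuotientMap_proj : IsOpenQuotientMap proj :=
  (IsOpenQuotientMap.piMap fun _ => QuotientAddGroup.isOpenQuotientMap_mk).comp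
    (EuclideanSpace.equiv (Fin 3) ℝ).toHomeomorph.isOpenQuotientMap

theorem continuous_proj : Continuous proj := isOpenQuotientMap_proj.continuous

theorem proj_add (x y : V3) : proj (x + y) = proj x + proj y := by
  ext i
  simp [proj]

theorem proj_neg (x : V3) : proj (-x) = -proj x := by
  ext i
  simp [proj]

theorem integral_mFourier_mul_comp_add_proj (f : T3 → ℂ) (k : Fin 3 → ℤ) (y : V3) :
    ∫ x, UnitAddTorus.mFourier (-k) x * f (x + proj y)
      = (𝐞 ⟪y, vec k⟫ : ℂ) * ∫ x, UnitAddTorus.mFourier (-k) x * f x := by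
  have hphase (x : T3) : UnitAddTorus.mFourier (-k) x
      = (𝐞 ⟪y, vec k⟫ : ℂ) * UnitAddTorus.mFourier (-k) (x + proj y) := by
    rw [mFourier_apply_add, mFourier_neg_proj, mul_left_comm, ← Circle.coe_mul,
      ← AddChar.map_add_eq_mul]
    simp
  rw [← integral_add_right_eq_self (fun x => UnitAddTorus.mFourier (-k) x * f x) (proj y),
    ← integral_const_mul]
  exact integral_congr_ae (.of_forall fun x => by simp only [hphase x, mul_assoc])

theorem fourierX_comp_add_proj (f : T3 → ℝ) (k : Fin 3 → ℤ) (y : V3) :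
    fourierX (fun x => f (x + proj y)) k = (𝐞 ⟪y, vec k⟫ : ℂ) * fourierX f k := by
  rw [fourierX_eq_integral, fourierX_eq_integral,
    integral_mFourier_mul_comp_add_proj fun x => (f x : ℂ)]

theorem fourierX_sub {f g : T3 → ℝ} (hf : Integrable f) (hg : Integrable g) (k : Fin 3 → ℤ) :
    fourierX (fun x => f x - g x) k = fourierX f k - fourierX g k := by
  have hint {h : T3 → ℝ} (hh : Integrable h) :
      Integrable fun x => UnitAddTorus.mFourier (-k) x * (h x : ℂ) :=
    hh.ofReal.bdd_mul (c := 1) (UnitAddTorus.mFourier (-k)).continuous.aestronglyMeasurable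
      (.of_forall fun _ => (norm_mFourier_apply _ _).le)
  simp only [fourierX_eq_integral, Complex.ofReal_sub, mul_sub]
  exact integral_sub (hint hf) (hint hg)

theorem fourierX_const_of_ne_zero (c : ℝ) {k : Fin 3 → ℤ} (hk : k ≠ 0) :
    fourierX (fun _ => c) k = 0 := by
  -- The translation by half a period of the mode `k` changes its sign.
  have hnorm : ‖vec k‖ ≠ 0 := norm_ne_zero_iff.2 (vec_ne_zero hk)
  have hhalf : ⟪(2 * ‖vec k‖ ^ 2)⁻¹ • vec k, vec k⟫ = 1 / 2 := by
    rw [real_inner_smul_left, real_inner_self_eq_norm_sq]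
    field_simp
  have hsign : (𝐞 (1 / 2) : ℂ) = -1 := by
    rw [Real.fourierChar_apply, ← Complex.exp_pi_mul_I]
    push_cast
    ring_nf
  have htranslate := fourierX_comp_add_proj (fun _ => c) k ((2 * ‖vec k‖ ^ 2)⁻¹ • vec k)
  rw [hhalf, hsign, neg_one_mul] at htranslate
  exact self_eq_neg.1 htranslate

theorem integrable_potential {W n : T3 → ℝ} (hW : Integrable W) (hn : Integrable n) :
    Integrable (potential W n) :=
  hW.integrable_convolution (ContinuousLinearMap.mul ℝ ℝ) hn

theorem fourierX_potential {W n : T3 → ℝ} (hW : Integrable W) (hn : Integrable n)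
    (k : Fin 3 → ℤ) : fourierX (potential W n) k = fourierX W k * fourierX n k := by
  have hintg : Integrable (Function.uncurry fun (x y : T3) =>
      UnitAddTorus.mFourier (-k) x * ((W y : ℂ) * (n (x - y) : ℂ))) (volume.prod volume) := by
    refine integrable_mFourier_fst_mul (f := fun p => (W p.2 : ℂ) * (n (p.1 - p.2) : ℂ)) ?_ (-k)
    simpa using (hW.convolution_integrand (ContinuousLinearMap.mul ℝ ℝ) hn).ofReal (𝕜 := ℂ)
  calc fourierX (potential W n) k
      = ∫ x : T3, ∫ y : T3, UnitAddTorus.mFourier (-k) x * ((W y : ℂ) * (n (x - y) : ℂ)) := by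
        simp only [fourierX_eq_integral, potential, integral_const_mul,
          ← integral_complex_ofReal, Complex.ofReal_mul]
    _ = ∫ y : T3, ∫ x : T3, UnitAddTorus.mFourier (-k) x * ((W y : ℂ) * (n (x - y) : ℂ)) :=
        integral_integral_swap hintg
    _ = ∫ y : T3, UnitAddTorus.mFourier (-k) y * (W y : ℂ) * fourierX n k := by
        refine integral_congr_ae (.of_forall fun y => ?_)
        simp only [fourierX_eq_integral]
        rw [← integral_add_right_eq_self _ y, ← integral_const_mul]
        simp only [mFourier_apply_add, add_sub_cancel_right]
        exact integral_congr_ae (.of_forall fun x => by ring)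
    _ = fourierX W k * fourierX n k := by rw [integral_mul_const, ← fourierX_eq_integral]

section PhaseSpace

variable {f : T3 → V3 → ℝ}

theorem integrable_density (hf : Integrable fun p : T3 × V3 => f p.1 p.2) :
    Integrable (density f) :=
  Integrable.integral_prod_left hf

theorem integrable_mFourier_mul_phaseSpace (hf : Integrable fun p : T3 × V3 => f p.1 p.2)
    (k : Fin 3 → ℤ) :
    Integrable fun p : T3 × V3 => UnitAddTorus.mFourier (-k) p.1 * (f p.1 p.2 : ℂ) :=
  integrable_mFourier_fst_mul hf.ofReal (-k)

theorem integrable_fourierX (hf : Integrable fun p : T3 × V3 => f p.1 p.2) (k : Fin 3 → ℤ) :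
    Integrable fun v : V3 => fourierX (fun x => f x v) k := by
  simp only [fourierX_eq_integral]
  exact (integrable_mFourier_mul_phaseSpace hf k).integral_prod_right

theorem fourierX_density (hf : Integrable fun p : T3 × V3 => f p.1 p.2) (k : Fin 3 → ℤ) :
    fourierX (density f) k = fourierXV f k 0 := by
  simp only [fourierXV, fourier_eq_integral_mul, fourierX_eq_integral, density,
    ← integral_complex_ofReal, ← integral_const_mul]
  rw [integral_integral_swap (integrable_mFourier_mul_phaseSpace hf k)]
  simp

theorem norm_fourierXV_le_integral_abs (hf : Integrable fun p : T3 × V3 => f p.1 p.2)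
    (k : Fin 3 → ℤ) (η : V3) : ‖fourierXV f k η‖ ≤ ∫ p : T3 × V3, |f p.1 p.2| := by
  have habs : Integrable (Function.uncurry fun (x : T3) (v : V3) => |f x v|)
      (volume.prod volume) := hf.abs
  calc ‖fourierXV f k η‖ ≤ ∫ v, ‖fourierX (fun x => f x v) k‖ :=
        VectorFourier.norm_fourierIntegral_le_integral_norm _ _ _ _ _
    _ ≤ ∫ v : V3, ∫ x : T3, |f x v| := by
        refine integral_mono (integrable_fourierX hf k).norm habs.integral_prod_right fun v => ?_
        simp only [fourierX_eq_integral]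
        refine (norm_integral_le_integral_norm _).trans_eq ?_
        simp [norm_mFourier_apply]
    _ = ∫ p : T3 × V3, |f p.1 p.2| := by
        rw [← integral_integral_swap habs, integral_integral habs]
        rfl

end PhaseSpace

/-! ### Fourier modes of `Θ_ħ[φ] w⁰` -/

theorem integrable_translate_mul {φ : T3 → ℝ} (hφ : Integrable φ) {G : V3 → ℂ}
    (hG : Integrable G) (c : ℝ) :
    Integrable (fun p : T3 × V3 => (φ (p.1 + proj (c • p.2)) : ℂ) * G p.2)
      (volume.prod volume) := by
  have hshear : MeasurePreserving (fun p : V3 × T3 => (p.1, p.2 + proj (c • p.1)))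
      (volume.prod volume) (volume.prod volume) := by
    refine (MeasurePreserving.id (volume : Measure V3)).skew_product
      (g := fun (ξ : V3) (x : T3) => x + proj (c • ξ)) ?_
      (.of_forall fun ξ => map_add_right_eq_self _ _)
    exact (continuous_snd.add (continuous_proj.comp (continuous_fst.const_smul c))).measurable
  refine (hshear.integrable_comp_of_integrable (hG.mul_prod hφ.ofReal)).swap.congr
    (.of_forall fun p => ?_)
  exact mul_comm _ _

theorem integrable_translate_sub_mul {φ : T3 → ℝ} (hφ : Integrable φ) {G : V3 → ℂ}
    (hG : Integrable G) (c : ℝ) :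
    Integrable (fun p : T3 × V3 =>
      ((φ (p.1 + proj (c • p.2)) - φ (p.1 - proj (c • p.2)) : ℝ) : ℂ) * G p.2)
      (volume.prod volume) := by
  refine ((integrable_translate_mul hφ hG c).sub (integrable_translate_mul hφ hG (-c))).congr
    (.of_forall fun p => ?_)
  simp only [Pi.sub_apply, neg_smul, proj_neg, ← sub_eq_add_neg, ← sub_mul, Complex.ofReal_sub]

theorem fourierX_translate_sub {φ : T3 → ℝ} (hφ : Integrable φ) (k : Fin 3 → ℤ) (y : V3) :
    fourierX (fun x => φ (x + proj y) - φ (x - proj y)) k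
      = ((𝐞 ⟪y, vec k⟫ : ℂ) - (𝐞 (-⟪y, vec k⟫) : ℂ)) * fourierX φ k := by
  simp only [sub_eq_add_neg _ (proj y), ← proj_neg]
  rw [fourierX_sub (hφ.comp_add_right _) (hφ.comp_add_right _), fourierX_comp_add_proj,
    fourierX_comp_add_proj, inner_neg_left, sub_mul]

theorem FourierInvertible.integral_fourierChar_mul_fourier_translate {g : V3 → ℂ}
    (hg : FourierInvertible g) (v u : V3) (c : ℝ) :
    ∫ ξ, (𝐞 ⟪c • ξ, u⟫ : ℂ) * ((𝐞 ⟪v, ξ⟫ : ℂ) * 𝓕 g ξ) = g (v + c • u) := by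
  rw [← hg.integral_fourierChar_mul_fourier]
  refine integral_congr_ae (.of_forall fun ξ => ?_)
  simp only [inner_add_right, inner_smul_left, inner_smul_right, AddChar.map_add_eq_mul,
    Circle.coe_mul, real_inner_comm v ξ, conj_trivial]
  ring

theorem FourierInvertible.integral_mFourier_mul_integral_translate_sub {g : V3 → ℂ}
    (hg : FourierInvertible g) {φ : T3 → ℝ} (hφ : Integrable φ) (c : ℝ) (k : Fin 3 → ℤ) (v : V3) :
    ∫ x : T3, UnitAddTorus.mFourier (-k) x *
        ∫ ξ : V3, ((φ (x + proj (c • ξ)) - φ (x - proj (c • ξ)) : ℝ) : ℂ)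
          * ((𝐞 ⟪v, ξ⟫ : ℂ) * 𝓕 g ξ)
      = fourierX φ k * (g (v + c • vec k) - g (v - c • vec k)) := by
  have hG : Integrable fun ξ => (𝐞 ⟪v, ξ⟫ : ℂ) * 𝓕 g ξ :=
    integrable_fourierChar_mul hg.integrable_fourier (by fun_prop)
  simp only [← integral_const_mul]
  rw [integral_integral_swap (integrable_mFourier_fst_mul
    (f := fun p : T3 × V3 => ((φ (p.1 + proj (c • p.2)) - φ (p.1 - proj (c • p.2)) : ℝ) : ℂ)
      * ((𝐞 ⟪v, p.2⟫ : ℂ) * 𝓕 g p.2)) (integrable_translate_sub_mul hφ hG c) (-k))]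
  calc _ = ∫ ξ, fourierX φ k * ((𝐞 ⟪c • ξ, vec k⟫ : ℂ) * ((𝐞 ⟪v, ξ⟫ : ℂ) * 𝓕 g ξ)
          - (𝐞 ⟪(-c) • ξ, vec k⟫ : ℂ) * ((𝐞 ⟪v, ξ⟫ : ℂ) * 𝓕 g ξ)) := by
        refine integral_congr_ae (.of_forall fun ξ => ?_)
        simp only [← mul_assoc (UnitAddTorus.mFourier (-k) _)]
        rw [integral_mul_const, ← fourierX_eq_integral fun x =>
          φ (x + proj (c • ξ)) - φ (x - proj (c • ξ)), fourierX_translate_sub hφ, neg_smul,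
          inner_neg_left]
        ring
    _ = fourierX φ k * (g (v + c • vec k) - g (v - c • vec k)) := by
        rw [integral_const_mul, integral_sub (integrable_fourierChar_mul hG (by fun_prop))
          (integrable_fourierChar_mul hG (by fun_prop)),
          hg.integral_fourierChar_mul_fourier_translate,
          hg.integral_fourierChar_mul_fourier_translate, neg_smul, ← sub_eq_add_neg]

-- The substitution `η = 2πξ` absorbs the factor `(2π)⁻³`.
theorem theta_eq_integral_fourier (hbar m : ℝ) (φ : T3 → ℝ) (w0 : V3 → ℝ) (x : T3) (v : V3) :
    theta hbar m φ (fun _ v' => w0 v') x v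
      = Complex.I * m / hbar * ∫ ξ : V3,
        ((φ (x + proj ((hbar / (2 * m) * (2 * Real.pi)) • ξ))
            - φ (x - proj ((hbar / (2 * m) * (2 * Real.pi)) • ξ)) : ℝ) : ℂ)
          * ((𝐞 ⟪v, ξ⟫ : ℂ) * 𝓕 (fun v' => (w0 v' : ℂ)) ξ) := by
  have hpi : (Real.pi : ℂ) ≠ 0 := by exact_mod_cast Real.pi_ne_zero
  have hinner (η : V3) : ∫ v' : V3,
      (((φ (x + proj ((hbar / (2 * m)) • η)) - φ (x - proj ((hbar / (2 * m)) • η))) / hbar : ℝ) : ℂ)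
        * (w0 v' : ℂ) * Complex.exp (Complex.I * ((⟪v - v', η⟫ : ℝ) : ℂ))
      = (hbar : ℂ)⁻¹ * (((φ (x + proj ((hbar / (2 * m)) • η))
            - φ (x - proj ((hbar / (2 * m)) • η)) : ℝ) : ℂ)
          * ((𝐞 ⟪v, (2 * Real.pi)⁻¹ • η⟫ : ℂ)
            * 𝓕 (fun v' => (w0 v' : ℂ)) ((2 * Real.pi)⁻¹ • η))) := by
    simp only [fourier_eq_integral_mul, ← integral_const_mul]
    refine integral_congr_ae (.of_forall fun v' => ?_)
    have hphase : Complex.exp (Complex.I * ((⟪v - v', η⟫ : ℝ) : ℂ))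
        = (𝐞 ⟪v, (2 * Real.pi)⁻¹ • η⟫ : ℂ) * (𝐞 (-⟪v', (2 * Real.pi)⁻¹ • η⟫) : ℂ) := by
      rw [← Circle.coe_mul, ← AddChar.map_add_eq_mul, Real.fourierChar_apply, ← sub_eq_add_neg,
        ← inner_sub_left, inner_smul_right, mul_comm Complex.I, mul_inv_cancel_left₀]
      positivity
    simp only [hphase]
    push_cast
    ring
  have hsubst := Measure.integral_comp_inv_smul (volume : Measure V3) (fun ξ : V3 =>
    ((φ (x + proj ((hbar / (2 * m) * (2 * Real.pi)) • ξ))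
        - φ (x - proj ((hbar / (2 * m) * (2 * Real.pi)) • ξ)) : ℝ) : ℂ)
      * ((𝐞 ⟪v, ξ⟫ : ℂ) * 𝓕 (fun v' => (w0 v' : ℂ)) ξ)) (2 * Real.pi)
  simp only [mul_smul (hbar / (2 * m)), smul_inv_smul₀ Real.two_pi_pos.ne',
    finrank_euclideanSpace_fin, abs_of_pos (pow_pos Real.two_pi_pos 3), Complex.real_smul]
    at hsubst
  simp only [theta, hinner, integral_const_mul, hsubst, mul_smul (hbar / (2 * m))]
  push_cast
  field_simp

/-- The increment `w⁰(v - ħκ/2m) - w⁰(v + ħκ/2m)` of the profile for the wave vector `κ = 2πk`,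
which drives the mode `k` of the solution; `deltaW` is its quotient by `ħ|κ|/m`. -/
noncomputable def increment (hbar m : ℝ) (w0 : V3 → ℝ) (k : Fin 3 → ℤ) (v : V3) : ℝ :=
  w0 (v - (hbar / (2 * m)) • ((2 * Real.pi) • vec k))
    - w0 (v + (hbar / (2 * m)) • ((2 * Real.pi) • vec k))

theorem increment_zero_right (hbar m : ℝ) (w0 : V3 → ℝ) : increment hbar m w0 0 = 0 := by
  ext v
  simp [increment, vec_zero]

section Increment

variable {hbar m : ℝ} {w0 : V3 → ℝ}

theorem integrable_increment (hw0 : FourierInvertible fun v => (w0 v : ℂ)) (k : Fin 3 → ℤ) :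
    Integrable (increment hbar m w0 k) := by
  have hint : Integrable w0 := hw0.integrable.re
  exact (hint.comp_sub_right _).sub (hint.comp_add_right _)

theorem integral_mFourier_mul_theta (hw0 : FourierInvertible fun v => (w0 v : ℂ)) {φ : T3 → ℝ}
    (hφ : Integrable φ) (k : Fin 3 → ℤ) (v : V3) :
    ∫ x : T3, UnitAddTorus.mFourier (-k) x * theta hbar m φ (fun _ v' => w0 v') x v
      = -(Complex.I * m / hbar * (fourierX φ k * increment hbar m w0 k v)) := by
  simp only [theta_eq_integral_fourier, mul_left_comm _ (Complex.I * m / hbar : ℂ)]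
  rw [integral_const_mul, hw0.integral_mFourier_mul_integral_translate_sub hφ, increment,
    smul_smul (hbar / (2 * m))]
  push_cast
  ring

theorem increment_eq_mul_deltaW (hhbar : hbar ≠ 0) (hm : m ≠ 0) {k : Fin 3 → ℤ} (hk : k ≠ 0)
    (x : T3) (v : V3) : increment hbar m w0 k v
      = hbar / m * ‖(2 * Real.pi) • vec k‖ * deltaW hbar m k (fun _ v' => w0 v') x v :=
  (mul_div_cancel₀ _ (mul_ne_zero (div_ne_zero hhbar hm) (norm_ne_zero_iff.2
    (smul_ne_zero Real.two_pi_pos.ne' (vec_ne_zero hk))))).symm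

end Increment

/-! ### Solutions along the free flow -/

theorem hasDerivAt_integral_of_compactSpace {X : Type*} [TopologicalSpace X] [CompactSpace X]
    [SecondCountableTopology X] [MeasurableSpace X] [BorelSpace X] {μ : Measure X}
    [IsFiniteMeasure μ] {E : Type*} [NormedAddCommGroup E] [NormedSpace ℝ E]
    {F F' : ℝ → X → E} {U : Set ℝ} {t : ℝ} (hU : U ∈ nhds t) (hF : ∀ s ∈ U, Continuous (F s))
    (hF' : ContinuousOn (Function.uncurry F') (U ×ˢ Set.univ))
    (hderiv : ∀ s ∈ U, ∀ x, HasDerivAt (fun s => F s x) (F' s x) s) :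
    HasDerivAt (fun s => ∫ x, F s x ∂μ) (∫ x, F' t x ∂μ) t := by
  obtain ⟨K, hK, hKU, hKc⟩ := LocallyCompactSpace.local_compact_nhds t U hU
  obtain ⟨M, hM⟩ := (hKc.prod isCompact_univ).exists_bound_of_continuousOn
    (hF'.mono (Set.prod_mono_left hKU))
  have hF't : Continuous (F' t) :=
    hF'.comp_continuous (Continuous.prodMk_right t) fun _ => ⟨mem_of_mem_nhds hU, trivial⟩
  refine (hasDerivAt_integral_of_dominated_loc_of_deriv_le (bound := fun _ => M) hK ?_ ?_
    hF't.aestronglyMeasurable (.of_forall fun x s hs => hM (s, x) ⟨hs, trivial⟩)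
    (integrable_const M) (.of_forall fun x s hs => hderiv s (hKU hs) x)).2
  · filter_upwards [hU] with s hs using (hF s hs).aestronglyMeasurable
  · exact (hF t (mem_of_mem_nhds hU)).integrable_of_hasCompactSupport
      (HasCompactSupport.of_compactSpace _)

theorem integrable_prod_mul_of_forall {α β : Type*} [MeasurableSpace α] [MeasurableSpace β]
    {μ : Measure α} {ν : Measure β} [SFinite μ] [SFinite ν] {f : α → ℂ} {g : β → ℂ}
    (hf : Integrable f μ) (hfg : ∀ x, Integrable (fun y => f x * g y) ν) :
    Integrable (fun p => f p.1 * g p.2) (μ.prod ν) := by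
  rcases eq_or_ne f 0 with rfl | hne
  · simp
  · obtain ⟨x, hx⟩ := Function.ne_iff.1 hne
    exact hf.mul_prod ((integrable_const_mul_iff (IsUnit.mk0 _ hx) g).1 (hfg x))

theorem fourier_integral_modulation {V : Type*} [NormedAddCommGroup V] [InnerProductSpace ℝ V]
    [FiniteDimensional ℝ V] [MeasurableSpace V] [BorelSpace V] {ν : Measure ℝ} [SFinite ν]
    {f : V → ℂ} {a : ℝ → ℂ}
    (h : Integrable (fun p : V × ℝ => f p.1 * a p.2) (volume.prod ν)) (u ξ : V) :
    𝓕 (fun v => ∫ s, a s * (f v * (𝐞 (s * ⟪v, u⟫) : ℂ)) ∂ν) ξ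
      = ∫ s, a s * 𝓕 f (ξ - s • u) ∂ν := by
  have hphase (v : V) (s : ℝ) : (𝐞 (-⟪v, ξ⟫) : ℂ) * (𝐞 (s * ⟪v, u⟫) : ℂ)
      = (𝐞 (-⟪v, ξ - s • u⟫) : ℂ) := by
    rw [← Circle.coe_mul, ← AddChar.map_add_eq_mul, inner_sub_right, inner_smul_right, neg_sub,
      neg_add_eq_sub]
  have hprod : Integrable (Function.uncurry fun (v : V) (s : ℝ) =>
      (𝐞 (-⟪v, ξ - s • u⟫) : ℂ) * (f v * a s)) (volume.prod ν) :=
    integrable_fourierChar_mul h (by fun_prop)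
  calc 𝓕 (fun v => ∫ s, a s * (f v * (𝐞 (s * ⟪v, u⟫) : ℂ)) ∂ν) ξ
      = ∫ v, ∫ s, (𝐞 (-⟪v, ξ - s • u⟫) : ℂ) * (f v * a s) ∂ν := by
        simp only [fourier_eq_integral_mul, ← integral_const_mul, ← hphase]
        exact integral_congr_ae (.of_forall fun v =>
          integral_congr_ae (.of_forall fun s => by ring))
    _ = ∫ s, (∫ v, (𝐞 (-⟪v, ξ - s • u⟫) : ℂ) * (f v * a s)) ∂ν := integral_integral_swap hprod
    _ = ∫ s, a s * 𝓕 f (ξ - s • u) ∂ν := by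
        simp only [fourier_eq_integral_mul, ← integral_const_mul]
        exact integral_congr_ae (.of_forall fun s =>
          integral_congr_ae (.of_forall fun v => by ring))

/-- The Fourier coefficient in `x` of `w(s, x + sv, v)`, the profile of `w` transported back along
the free flow. -/
noncomputable def profileMode (w : ℝ → T3 → V3 → ℝ) (k : Fin 3 → ℤ) (v : V3) (s : ℝ) : ℂ :=
  fourierX (fun x => w s (x + proj (s • v)) v) k

theorem profileMode_eq_mul (w : ℝ → T3 → V3 → ℝ) (k : Fin 3 → ℤ) (v : V3) (s : ℝ) :
    profileMode w k v s = (𝐞 (s * ⟪v, vec k⟫) : ℂ) * fourierX (fun x => w s x v) k := by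
  rw [profileMode, fourierX_comp_add_proj fun x => w s x v, real_inner_smul_left]

theorem fourier_profileMode (w : ℝ → T3 → V3 → ℝ) (k : Fin 3 → ℤ) (s : ℝ) (ξ : V3) :
    𝓕 (fun v => profileMode w k v s) ξ = fourierXV (w s) k (ξ - s • vec k) := by
  simp only [fourierXV, fourier_eq_integral_mul, profileMode_eq_mul, ← mul_assoc,
    ← Circle.coe_mul, ← AddChar.map_add_eq_mul, inner_sub_right, inner_smul_right, neg_sub,
    neg_add_eq_sub]

/-- The time dependent amplitude `(i/ħ) e φ̂(s,k)` with which the increment of `w⁰` drives the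
profile of the mode `k`. -/
noncomputable def forcing (hbar e : ℝ) (W : T3 → ℝ) (w : ℝ → T3 → V3 → ℝ) (k : Fin 3 → ℤ) (s : ℝ) :
    ℂ :=
  Complex.I / hbar * (e * fourierX (potential W (density (w s))) k)

namespace IsSolution

variable {hbar m e : ℝ} {W : T3 → ℝ} {w0 : V3 → ℝ} {wI : T3 → V3 → ℝ} {w : ℝ → T3 → V3 → ℝ}

theorem continuous_max_zero (hsol : IsSolution hbar m e W w0 wI w) (v : V3) :
    Continuous fun p : ℝ × T3 => w (max p.1 0) p.2 v := by
  rw [← (IsOpenQuotientMap.id.prodMap isOpenQuotientMap_proj).continuous_comp_iff]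
  exact (hsol.continuousOn v).comp_continuous (f := fun q : ℝ × V3 => (max q.1 0, q.2))
    (by fun_prop) fun q => by simp

theorem continuous_section (hsol : IsSolution hbar m e W w0 wI w) {t : ℝ} (ht : 0 ≤ t) (v : V3) :
    Continuous fun x : T3 => w t x v := by
  simpa [Function.comp_def, max_eq_left ht] using
    (hsol.continuous_max_zero v).comp (Continuous.prodMk_right t)

theorem continuousOn_fourierX (hsol : IsSolution hbar m e W w0 wI w) (k : Fin 3 → ℤ) (v : V3) :
    ContinuousOn (fun t => fourierX (fun x => w t x v) k) (Set.Ici 0) := by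
  have hcont : Continuous fun t : ℝ => ∫ x in (Set.univ : Set T3),
      UnitAddTorus.mFourier (-k) x * (w (max t 0) x v : ℂ) :=
    continuous_parametric_integral_of_continuous
      (((UnitAddTorus.mFourier (-k)).continuous.comp continuous_snd).mul
        (Complex.continuous_ofReal.comp (hsol.continuous_max_zero v))) isCompact_univ
  refine hcont.continuousOn.congr fun t ht => ?_
  simp only [fourierX_eq_integral, Measure.restrict_univ, max_eq_left (Set.mem_Ici.1 ht)]

theorem continuousOn_profileMode (hsol : IsSolution hbar m e W w0 wI w) (k : Fin 3 → ℤ) (v : V3) :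
    ContinuousOn (profileMode w k v) (Set.Ici 0) := by
  have hphase : Continuous fun s : ℝ => (𝐞 (s * ⟪v, vec k⟫) : ℂ) :=
    Real.differentiable_fourierChar.continuous.comp (by fun_prop)
  exact (hphase.continuousOn.mul (hsol.continuousOn_fourierX k v)).congr fun s _ =>
    profileMode_eq_mul w k v s

theorem hasFDerivAt_lift (hsol : IsSolution hbar m e W w0 wI w) {t : ℝ} (ht : 0 < t) (y v : V3) :
    HasFDerivAt (fun q : ℝ × V3 => w q.1 (proj q.2) v)
      (fderiv ℝ (fun q : ℝ × V3 => w q.1 (proj q.2) v) (t, y)) (t, y) :=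
  (((hsol.contDiffOn v).differentiableOn one_ne_zero).differentiableAt
    ((isOpen_Ioi.prod isOpen_univ).mem_nhds (Set.mk_mem_prod ht trivial))).hasFDerivAt

theorem fderiv_lift_apply (hsol : IsSolution hbar m e W w0 wI w) {t : ℝ} (ht : 0 < t) (y v : V3) :
    ((fderiv ℝ (fun q : ℝ × V3 => w q.1 (proj q.2) v) (t, y) (1, v) : ℝ) : ℂ)
      = -(((e / m : ℝ) : ℂ)
        * theta hbar m (potential W (density (w t))) (fun _ v' => w0 v') (proj y) v) := by
  have htime : HasDerivAt (fun s : ℝ => w s (proj y) v) _ t :=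
    (hsol.hasFDerivAt_lift ht y v).comp_hasDerivAt (f := fun s : ℝ => (s, y)) t
      ((hasDerivAt_id' t).prodMk (hasDerivAt_const t y))
  have hspace : HasFDerivAt (fun z : V3 => w t (proj z) v) _ y :=
    (hsol.hasFDerivAt_lift ht y v).comp y ((hasFDerivAt_const t y).prodMk (hasFDerivAt_id y))
  have heq := hsol.equation t ht y v
  rw [htime.deriv, hspace.fderiv] at heq
  rw [← eq_neg_of_add_eq_zero_left heq, show ((1 : ℝ), v) = (1, 0) + (0, v) by simp, map_add]
  simp

theorem hasDerivAt_trajectory (hsol : IsSolution hbar m e W w0 wI w) {t : ℝ} (ht : 0 < t) (x : T3)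
    (v : V3) :
    HasDerivAt (fun s : ℝ => (w s (x + proj (s • v)) v : ℂ))
      (-(((e / m : ℝ) : ℂ) * theta hbar m (potential W (density (w t))) (fun _ v' => w0 v')
        (x + proj (t • v)) v)) t := by
  obtain ⟨y, rfl⟩ := isOpenQuotientMap_proj.surjective x
  have hline : HasDerivAt (fun s : ℝ => (s, y + s • v)) ((1 : ℝ), v) t :=
    (hasDerivAt_id t).prodMk (by simpa using ((hasDerivAt_id t).smul_const v).const_add y)
  simp only [← proj_add]
  rw [← hsol.fderiv_lift_apply ht]
  exact ((hsol.hasFDerivAt_lift ht _ v).comp_hasDerivAt t hline).ofReal_comp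

theorem continuousOn_theta (hsol : IsSolution hbar m e W w0 wI w) (v : V3) :
    ContinuousOn (fun p : ℝ × T3 => -(((e / m : ℝ) : ℂ)
      * theta hbar m (potential W (density (w p.1))) (fun _ v' => w0 v') p.2 v))
      (Set.Ioi 0 ×ˢ Set.univ) := by
  have hopen : IsOpen (Set.Ioi (0 : ℝ) ×ˢ (Set.univ : Set V3)) := isOpen_Ioi.prod isOpen_univ
  rintro ⟨t, x⟩ ⟨ht, -⟩
  obtain ⟨y, rfl⟩ := isOpenQuotientMap_proj.surjective x
  have hmem : (t, y) ∈ Set.Ioi (0 : ℝ) ×ˢ (Set.univ : Set V3) := ⟨ht, trivial⟩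
  refine ContinuousAt.continuousWithinAt (?_ : ContinuousAt _ (Prod.map id proj (t, y)))
  rw [← (IsOpenQuotientMap.id.prodMap isOpenQuotientMap_proj).continuousAt_comp_iff]
  have hfderiv := ((hsol.contDiffOn v).continuousOn_fderiv_of_isOpen hopen le_rfl).continuousAt
    (hopen.mem_nhds hmem)
  refine (Complex.continuous_ofReal.continuousAt.comp
    (hfderiv.clm_apply (g := fun _ => ((1 : ℝ), v)) continuousAt_const)).congr ?_
  filter_upwards [hopen.mem_nhds hmem] with q hq using hsol.fderiv_lift_apply hq.1 q.2 v

theorem hasDerivAt_profileMode (hsol : IsSolution hbar m e W w0 wI w) (hm : m ≠ 0)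
    (hW : Integrable W) (hw0 : FourierInvertible fun v => (w0 v : ℂ)) {t : ℝ} (ht : 0 < t)
    (k : Fin 3 → ℤ) (v : V3) :
    HasDerivAt (profileMode w k v) (forcing hbar e W w k t
      * (increment hbar m w0 k v * (𝐞 (t * ⟪v, vec k⟫) : ℂ))) t := by
  have hφ : Integrable (potential W (density (w t))) :=
    integrable_potential hW (integrable_density (hsol.integrable t ht.le))
  have hderiv := hasDerivAt_integral_of_compactSpace (μ := (volume : Measure T3))
    (F := fun s x => UnitAddTorus.mFourier (-k) x * (w s (x + proj (s • v)) v : ℂ))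
    (F' := fun s x => UnitAddTorus.mFourier (-k) x * -(((e / m : ℝ) : ℂ)
      * theta hbar m (potential W (density (w s))) (fun _ v' => w0 v') (x + proj (s • v)) v))
    (Ioi_mem_nhds ht)
    (fun s hs => (UnitAddTorus.mFourier (-k)).continuous.mul (Complex.continuous_ofReal.comp
      ((hsol.continuous_section (le_of_lt hs) v).comp (continuous_add_const _))))
    (((UnitAddTorus.mFourier (-k)).continuous.comp continuous_snd).continuousOn.mul
      ((hsol.continuousOn_theta v).comp (f := fun p : ℝ × T3 => (p.1, p.2 + proj (p.1 • v)))
        (Continuous.continuousOn (continuous_fst.prodMk (continuous_snd.add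
          (continuous_proj.comp (continuous_fst.smul continuous_const)))))
        fun p hp => ⟨hp.1, trivial⟩))
    fun s hs x => (hsol.hasDerivAt_trajectory hs x v).const_mul _
  simp only [← fourierX_eq_integral] at hderiv
  convert! hderiv using 1
  rw [integral_mFourier_mul_comp_add_proj fun x => -(((e / m : ℝ) : ℂ)
      * theta hbar m (potential W (density (w t))) (fun _ v' => w0 v') x v)]
  simp only [mul_neg, mul_left_comm _ ((e / m : ℝ) : ℂ)]
  rw [integral_neg, integral_const_mul, integral_mFourier_mul_theta hw0 hφ, real_inner_smul_left,
    forcing]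
  have hm' : (m : ℂ) ≠ 0 := by exact_mod_cast hm
  push_cast
  field_simp

theorem norm_forcing_le (hsol : IsSolution hbar m e W w0 wI w) (hhbar : 0 < hbar)
    (hW : Integrable W) {k : Fin 3 → ℤ} (hWk : ‖fourierX W k‖ ≤ 1) {s : ℝ} (hs : 0 ≤ s) :
    ‖forcing hbar e W w k s‖ ≤ |e| / hbar * ‖fourierXV (w s) k 0‖ := by
  have hns := hsol.integrable s hs
  rw [forcing, fourierX_potential hW (integrable_density hns), fourierX_density hns]
  simp only [norm_mul, norm_div, Complex.norm_I, Complex.norm_real, Real.norm_eq_abs,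
    abs_of_pos hhbar]
  calc 1 / hbar * (|e| * (‖fourierX W k‖ * ‖fourierXV (w s) k 0‖))
      ≤ 1 / hbar * (|e| * (1 * ‖fourierXV (w s) k 0‖)) := by gcongr
    _ = |e| / hbar * ‖fourierXV (w s) k 0‖ := by ring

theorem exists_norm_density_mode_le (hsol : IsSolution hbar m e W w0 wI w) (k : Fin 3 → ℤ) (T : ℝ) :
    ∃ B, ∀ s, 0 ≤ s → s ≤ T → ‖fourierXV (w s) k 0‖ ≤ B := by
  obtain ⟨B, hB⟩ := hsol.locally_bounded T
  exact ⟨B, fun s hs hsT =>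
    (norm_fourierXV_le_integral_abs (hsol.integrable s hs) k 0).trans (hB s hs hsT)⟩

theorem integrableOn_forcing (hsol : IsSolution hbar m e W w0 wI w) (hhbar : 0 < hbar) (hm : m ≠ 0)
    (hW : Integrable W) (hw0 : FourierInvertible fun v => (w0 v : ℂ)) {k : Fin 3 → ℤ}
    (hWk : ‖fourierX W k‖ ≤ 1) (v : V3) (t : ℝ) :
    IntegrableOn (fun s => increment hbar m w0 k v * forcing hbar e W w k s) (Set.Ioc 0 t) := by
  -- Measurability in time is only available through the derivative of the profile.
  have hderiv : ∀ᵐ s ∂volume.restrict (Set.Ioc 0 t),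
      (𝐞 (-(s * ⟪v, vec k⟫)) : ℂ) * deriv (profileMode w k v) s
        = increment hbar m w0 k v * forcing hbar e W w k s := by
    filter_upwards [ae_restrict_mem measurableSet_Ioc] with s hs
    rw [(hsol.hasDerivAt_profileMode hm hW hw0 hs.1 k v).deriv, ← mul_assoc _ _ (𝐞 _ : ℂ),
      mul_comm, mul_assoc, ← Circle.coe_mul, ← AddChar.map_add_eq_mul]
    simp [mul_comm]
  obtain ⟨B, hB⟩ := hsol.exists_norm_density_mode_le k t
  refine Integrable.of_bound ?_ (|increment hbar m w0 k v| * (|e| / hbar * B)) ?_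
  · have hphase : Measurable fun s : ℝ => (𝐞 (-(s * ⟪v, vec k⟫)) : ℂ) :=
      (Real.differentiable_fourierChar.continuous.comp (by fun_prop)).measurable
    refine AEStronglyMeasurable.congr ?_ hderiv
    exact (hphase.mul (measurable_deriv _)).aestronglyMeasurable
  · filter_upwards [ae_restrict_mem measurableSet_Ioc] with s hs
    rw [norm_mul, Complex.norm_real, Real.norm_eq_abs]
    gcongr
    exact (hsol.norm_forcing_le hhbar hW hWk hs.1.le).trans
      (mul_le_mul_of_nonneg_left (hB s hs.1.le hs.2) (by positivity))

theorem profileMode_eq_add_integral (hsol : IsSolution hbar m e W w0 wI w) (hhbar : 0 < hbar)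
    (hm : m ≠ 0) (hW : Integrable W) (hw0 : FourierInvertible fun v => (w0 v : ℂ))
    {k : Fin 3 → ℤ} (hWk : ‖fourierX W k‖ ≤ 1) {t : ℝ} (ht : 0 ≤ t) (v : V3) :
    profileMode w k v t = fourierX (fun x => wI x v) k
      + ∫ s in (0 : ℝ)..t, forcing hbar e W w k s
        * (increment hbar m w0 k v * (𝐞 (s * ⟪v, vec k⟫) : ℂ)) := by
  have hint : IntervalIntegrable (fun s => forcing hbar e W w k s
      * (increment hbar m w0 k v * (𝐞 (s * ⟪v, vec k⟫) : ℂ))) volume 0 t := by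
    rw [intervalIntegrable_iff_integrableOn_Ioc_of_le ht]
    refine (integrable_fourierChar_mul (u := fun s => s * ⟪v, vec k⟫)
      (hsol.integrableOn_forcing hhbar hm hW hw0 hWk v t) (by fun_prop)).congr
      (.of_forall fun s => ?_)
    ring
  rw [intervalIntegral.integral_eq_sub_of_hasDerivAt_of_le ht
    ((hsol.continuousOn_profileMode k v).mono Set.Icc_subset_Ici_self)
    (fun s hs => hsol.hasDerivAt_profileMode hm hW hw0 hs.1 k v) hint]
  simp [profileMode_eq_mul w k v 0, hsol.initial]

theorem integrable_initial (hsol : IsSolution hbar m e W w0 wI w) :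
    Integrable fun p : T3 × V3 => wI p.1 p.2 := by
  simpa only [hsol.initial] using hsol.integrable 0 le_rfl

theorem duhamel (hsol : IsSolution hbar m e W w0 wI w) (hhbar : 0 < hbar) (hm : m ≠ 0)
    (hW : Integrable W) (hw0 : FourierInvertible fun v => (w0 v : ℂ)) {k : Fin 3 → ℤ}
    (hWk : ‖fourierX W k‖ ≤ 1) {t : ℝ} (ht : 0 ≤ t) (ξ : V3) :
    fourierXV (w t) k (ξ - t • vec k) = fourierXV wI k ξ
      + ∫ s in (0 : ℝ)..t, forcing hbar e W w k s
        * 𝓕 (fun v => (increment hbar m w0 k v : ℂ)) (ξ - s • vec k) := by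
  have hprod : Integrable (fun p : V3 × ℝ =>
      (increment hbar m w0 k p.1 : ℂ) * forcing hbar e W w k p.2)
      (volume.prod (volume.restrict (Set.Ioc 0 t))) :=
    integrable_prod_mul_of_forall (integrable_increment hw0 k).ofReal fun v =>
      hsol.integrableOn_forcing hhbar hm hW hw0 hWk v t
  have hsource : Integrable fun v => ∫ s in (0 : ℝ)..t, forcing hbar e W w k s
      * (increment hbar m w0 k v * (𝐞 (s * ⟪v, vec k⟫) : ℂ)) := by
    simp only [intervalIntegral.integral_of_le ht]
    refine (integrable_fourierChar_mul (u := fun p : V3 × ℝ => p.2 * ⟪p.1, vec k⟫) hprod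
      (by fun_prop)).integral_prod_left.congr (.of_forall fun v =>
        integral_congr_ae (.of_forall fun s => ?_))
    ring
  calc fourierXV (w t) k (ξ - t • vec k)
      = 𝓕 (fun v => fourierX (fun x => wI x v) k + ∫ s in (0 : ℝ)..t, forcing hbar e W w k s
        * (increment hbar m w0 k v * (𝐞 (s * ⟪v, vec k⟫) : ℂ))) ξ := by
        simp only [← fourier_profileMode,
          hsol.profileMode_eq_add_integral hhbar hm hW hw0 hWk ht]
    _ = fourierXV wI k ξ + ∫ s in (0 : ℝ)..t, forcing hbar e W w k s
        * 𝓕 (fun v => (increment hbar m w0 k v : ℂ)) (ξ - s • vec k) := by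
        simp only [intervalIntegral.integral_of_le ht] at hsource ⊢
        rw [← fourier_integral_modulation hprod]
        simp only [fourierXV, fourier_eq_integral_mul, mul_add]
        exact integral_add
          (integrable_fourierChar_mul (integrable_fourierX hsol.integrable_initial k) (by fun_prop))
          (integrable_fourierChar_mul hsource (by fun_prop))

end IsSolution

/-! ### Exponential decay of the modes -/

theorem integral_exp_neg_mul_abs_sub_le {c : ℝ} (hc : 0 < c) {t : ℝ} (ht : 0 ≤ t) (a : ℝ) :
    ∫ s in (0 : ℝ)..t, Real.exp (-c * |s - a|) ≤ 2 / c := by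
  have hint : Integrable fun s : ℝ => Real.exp (-c * |s|) := integrable_exp_neg_mul_norm volume hc
  calc ∫ s in (0 : ℝ)..t, Real.exp (-c * |s - a|)
      ≤ ∫ s, Real.exp (-c * |s - a|) := by
        rw [intervalIntegral.integral_of_le ht]
        exact setIntegral_le_integral (hint.comp_sub_right a)
          (.of_forall fun s => (Real.exp_pos _).le)
    _ = 2 * ∫ s in Set.Ioi 0, Real.exp (-c * s) := by
        rw [integral_sub_right_eq_self (fun s : ℝ => Real.exp (-c * |s|)),
          integral_comp_abs (f := fun s => Real.exp (-c * s))]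
    _ = 2 / c := by
        rw [integral_exp_mul_Ioi (neg_lt_zero.2 hc), mul_zero, Real.exp_zero, neg_div_neg_eq,
          mul_one_div]

theorem le_two_mul_of_forall_le_add_half {ι : Type*} {s : Set ι} {q : ι → ℝ} {δ : ℝ}
    (hbdd : BddAbove (q '' s))
    (h : ∀ S, (∀ x ∈ s, q x ≤ S) → ∀ x ∈ s, q x ≤ δ + S / 2) {x : ι} (hx : x ∈ s) :
    q x ≤ 2 * δ := by
  have hle : ∀ y ∈ s, q y ≤ sSup (q '' s) := fun y hy => le_csSup hbdd (Set.mem_image_of_mem q hy)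
  have hsup : sSup (q '' s) ≤ δ + sSup (q '' s) / 2 :=
    csSup_le ⟨q x, Set.mem_image_of_mem q hx⟩ (Set.forall_mem_image.2 (h _ hle))
  linarith [hle x hx]

section DecayWeight

variable {V : Type*} [NormedAddCommGroup V]

/-- The weight `e^{-2πλ|ξ|} e^{-2πμ|u|}` measuring the decay of the mode with wave vector `u` in
the Fourier variable `ξ = η + tu` dual to the velocity along the free flow. -/
noncomputable def decayWeight (lam mu : ℝ) (u ξ : V) : ℝ :=
  Real.exp (-2 * Real.pi * lam * ‖ξ‖) * Real.exp (-2 * Real.pi * mu * ‖u‖)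

theorem decayWeight_pos (lam mu : ℝ) (u ξ : V) : 0 < decayWeight lam mu u ξ :=
  mul_pos (Real.exp_pos _) (Real.exp_pos _)

theorem decayWeight_smul_self [NormedSpace ℝ V] (lam mu : ℝ) {s : ℝ} (hs : 0 ≤ s) (u : V) :
    decayWeight lam mu u (s • u) = Real.exp (-2 * Real.pi * (lam * s + mu) * ‖u‖) := by
  rw [decayWeight, norm_smul, Real.norm_of_nonneg hs, ← Real.exp_add]
  ring_nf

theorem decayWeight_smul_self_anti [NormedSpace ℝ V] {lam : ℝ} (hlam : 0 ≤ lam) (mu : ℝ) (u : V)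
    {s t : ℝ} (hs : 0 ≤ s) (hst : s ≤ t) :
    decayWeight lam mu u (t • u) ≤ decayWeight lam mu u (s • u) := by
  have := Real.pi_pos
  rw [decayWeight_smul_self lam mu hs, decayWeight_smul_self lam mu (hs.trans hst)]
  simp only [neg_mul]
  gcongr

theorem decayWeight_mul_exp_le {lam : ℝ} (hlam : 0 ≤ lam) (lamb mu : ℝ) (u ξ ζ : V) :
    decayWeight lam mu u ζ * Real.exp (-2 * Real.pi * lamb * ‖ξ - ζ‖)
      ≤ decayWeight lam mu u ξ * Real.exp (-(2 * Real.pi * (lamb - lam)) * ‖ξ - ζ‖) := by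
  have htri := mul_le_mul_of_nonneg_left (norm_le_norm_sub_add ξ ζ)
    (mul_nonneg Real.two_pi_pos.le hlam)
  simp only [decayWeight, ← Real.exp_add, Real.exp_le_exp]
  linarith

theorem norm_mul_le_decayWeight_mul_exp {lam lamb mu A B : ℝ} (hlam : 0 ≤ lam) {u ξ ζ : V}
    {x y : ℂ} (hx : ‖x‖ ≤ A * decayWeight lam mu u ζ)
    (hy : ‖y‖ ≤ B * Real.exp (-2 * Real.pi * lamb * ‖ξ - ζ‖)) :
    ‖x * y‖ ≤ A * B * decayWeight lam mu u ξ
      * Real.exp (-(2 * Real.pi * (lamb - lam)) * ‖ξ - ζ‖) := by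
  have hA : 0 ≤ A := nonneg_of_mul_nonneg_left ((norm_nonneg x).trans hx) (decayWeight_pos ..)
  have hB : 0 ≤ B := nonneg_of_mul_nonneg_left ((norm_nonneg y).trans hy) (Real.exp_pos _)
  calc ‖x * y‖ ≤ A * decayWeight lam mu u ζ
          * (B * Real.exp (-2 * Real.pi * lamb * ‖ξ - ζ‖)) := by
        rw [norm_mul]
        exact mul_le_mul hx hy (norm_nonneg y) ((norm_nonneg x).trans hx)
    _ = A * B * (decayWeight lam mu u ζ * Real.exp (-2 * Real.pi * lamb * ‖ξ - ζ‖)) := by ring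
    _ ≤ A * B * (decayWeight lam mu u ξ
          * Real.exp (-(2 * Real.pi * (lamb - lam)) * ‖ξ - ζ‖)) :=
        mul_le_mul_of_nonneg_left (decayWeight_mul_exp_le hlam lamb mu u ξ ζ) (mul_nonneg hA hB)
    _ = _ := (mul_assoc _ _ _).symm

end DecayWeight

section Convolution

variable {V : Type*} [NormedAddCommGroup V] [InnerProductSpace ℝ V]

theorem exists_norm_mul_abs_sub_le_norm_sub_smul (ξ u : V) :
    ∃ a : ℝ, ∀ s : ℝ, ‖u‖ * |s - a| ≤ ‖ξ - s • u‖ := by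
  rcases eq_or_ne u 0 with rfl | hu
  · exact ⟨0, fun s => by simp⟩
  have hnorm : 0 < ‖u‖ := norm_pos_iff.2 hu
  -- `a • u` is the orthogonal projection of `ξ` onto the line spanned by `u`.
  refine ⟨⟪ξ, u⟫ / ‖u‖ ^ 2, fun s => le_of_mul_le_mul_right ?_ hnorm⟩
  have hinner : ⟪ξ - s • u, u⟫ = -(‖u‖ ^ 2 * (s - ⟪ξ, u⟫ / ‖u‖ ^ 2)) := by
    rw [inner_sub_left, real_inner_smul_left, real_inner_self_eq_norm_sq]
    field_simp
    ring
  calc ‖u‖ * |s - ⟪ξ, u⟫ / ‖u‖ ^ 2| * ‖u‖ = |⟪ξ - s • u, u⟫| := by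
        rw [hinner, abs_neg, abs_mul, abs_of_nonneg (sq_nonneg ‖u‖)]
        ring
    _ ≤ ‖ξ - s • u‖ * ‖u‖ := abs_real_inner_le_norm _ _

theorem norm_integral_mul_comp_sub_smul_le {lam lamb mu A B t : ℝ} (hlam : 0 ≤ lam)
    (hlamb : lam < lamb) (ht : 0 ≤ t) {u : V} (hu : u ≠ 0) {α : ℝ → ℂ} {F : V → ℂ}
    (hα : ∀ s, 0 ≤ s → s ≤ t → ‖α s‖ ≤ A * decayWeight lam mu u (s • u))
    (hF : ∀ ξ, ‖F ξ‖ ≤ B * Real.exp (-2 * Real.pi * lamb * ‖ξ‖)) (ξ : V) :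
    ‖∫ s in (0 : ℝ)..t, α s * F (ξ - s • u)‖
      ≤ A * B / (Real.pi * (lamb - lam) * ‖u‖) * decayWeight lam mu u ξ := by
  have : 0 < ‖u‖ := norm_pos_iff.2 hu
  have : 0 < 2 * Real.pi * (lamb - lam) := mul_pos Real.two_pi_pos (sub_pos.2 hlamb)
  have hA : 0 ≤ A :=
    nonneg_of_mul_nonneg_left ((norm_nonneg _).trans (hα 0 le_rfl ht)) (decayWeight_pos ..)
  have hB : 0 ≤ B := nonneg_of_mul_nonneg_left ((norm_nonneg _).trans (hF 0)) (Real.exp_pos _)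
  have hweight := (decayWeight_pos lam mu u ξ).le
  obtain ⟨a, ha⟩ := exists_norm_mul_abs_sub_le_norm_sub_smul ξ u
  set c := 2 * Real.pi * (lamb - lam) * ‖u‖ with hc
  have hpointwise : ∀ s ∈ Set.Ioc 0 t, ‖α s * F (ξ - s • u)‖
      ≤ A * B * decayWeight lam mu u ξ * Real.exp (-c * |s - a|) := fun s hs => by
    refine (norm_mul_le_decayWeight_mul_exp hlam (hα s hs.1.le hs.2) (hF _)).trans ?_
    rw [hc, neg_mul, neg_mul, mul_assoc _ ‖u‖]
    gcongr
    exact ha s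
  calc ‖∫ s in (0 : ℝ)..t, α s * F (ξ - s • u)‖
      ≤ ∫ s in (0 : ℝ)..t, A * B * decayWeight lam mu u ξ * Real.exp (-c * |s - a|) :=
        intervalIntegral.norm_integral_le_of_norm_le ht (.of_forall hpointwise)
          (Continuous.intervalIntegrable (by fun_prop) _ _)
    _ ≤ A * B * decayWeight lam mu u ξ * (2 / c) := by
        rw [intervalIntegral.integral_const_mul]
        gcongr
        exact integral_exp_neg_mul_abs_sub_le (by positivity) ht a
    _ = A * B / (Real.pi * (lamb - lam) * ‖u‖) * decayWeight lam mu u ξ := by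
        rw [hc, mul_assoc 2, mul_assoc 2, div_mul_cancel_left₀ two_ne_zero]
        ring

theorem norm_le_of_volterra {lam lamb mu a B δ : ℝ} (hlam : 0 ≤ lam) (hlamb : lam < lamb)
    (ha : 0 ≤ a) {u : V} (hu : u ≠ 0) (hsmall : a * B ≤ Real.pi * (lamb - lam) * ‖u‖ / 2)
    {Ψ : ℝ → V → ℂ} {ψ F : V → ℂ} {α : ℝ → ℂ}
    (hΨ : ∀ t, 0 ≤ t → ∀ ξ, Ψ t ξ = ψ ξ + ∫ s in (0 : ℝ)..t, α s * F (ξ - s • u))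
    (hψ : ∀ ξ, ‖ψ ξ‖ ≤ δ * decayWeight lam mu u ξ)
    (hF : ∀ ξ, ‖F ξ‖ ≤ B * Real.exp (-2 * Real.pi * lamb * ‖ξ‖))
    (hα : ∀ s, 0 ≤ s → ‖α s‖ ≤ a * ‖Ψ s (s • u)‖)
    (hbdd : ∀ T, ∃ M, ∀ s, 0 ≤ s → s ≤ T → ‖Ψ s (s • u)‖ ≤ M) {t : ℝ} (ht : 0 ≤ t) (ξ : V) :
    ‖Ψ t ξ‖ ≤ 2 * δ * decayWeight lam mu u ξ := by
  have hpos := decayWeight_pos lam mu u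
  have hstep (S T : ℝ) (hT : 0 ≤ T)
      (hS : ∀ s, 0 ≤ s → s ≤ T → ‖Ψ s (s • u)‖ ≤ S * decayWeight lam mu u (s • u)) (ξ : V) :
      ‖Ψ T ξ‖ ≤ (δ + S / 2) * decayWeight lam mu u ξ := by
    have hS0 : 0 ≤ S :=
      nonneg_of_mul_nonneg_left ((norm_nonneg _).trans (hS 0 le_rfl hT)) (hpos _)
    have : 0 < lamb - lam := sub_pos.2 hlamb
    have hhalf : a * S * B / (Real.pi * (lamb - lam) * ‖u‖) ≤ S / 2 := by
      rw [div_le_iff₀ (by positivity)]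
      linarith [mul_le_mul_of_nonneg_left hsmall hS0]
    rw [hΨ T hT, add_mul]
    refine (norm_add_le _ _).trans (add_le_add (hψ ξ) ?_)
    refine (norm_integral_mul_comp_sub_smul_le hlam hlamb hT hu (fun s hs hsT => ?_) hF ξ).trans
      (mul_le_mul_of_nonneg_right hhalf (hpos ξ).le)
    rw [mul_assoc]
    exact (hα s hs).trans (mul_le_mul_of_nonneg_left (hS s hs hsT) ha)
  have hquot : ∀ s ∈ Set.Icc 0 t, ‖Ψ s (s • u)‖ / decayWeight lam mu u (s • u) ≤ 2 * δ := by
    intro s hs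
    refine le_two_mul_of_forall_le_add_half
      (q := fun s => ‖Ψ s (s • u)‖ / decayWeight lam mu u (s • u)) ?_ (fun S hS s hs => ?_) hs
    · obtain ⟨M, hM⟩ := hbdd t
      refine ⟨M / decayWeight lam mu u (t • u), Set.forall_mem_image.2 fun s hs => ?_⟩
      exact div_le_div₀ ((norm_nonneg _).trans (hM s hs.1 hs.2)) (hM s hs.1 hs.2) (hpos _)
        (decayWeight_smul_self_anti hlam mu u hs.1 hs.2)
    · rw [div_le_iff₀ (hpos _)]
      exact hstep S s hs.1
        (fun r hr hrs => (div_le_iff₀ (hpos _)).1 (hS r ⟨hr, hrs.trans hs.2⟩)) _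
  refine (hstep (2 * δ) t ht (fun s hs hst => (div_le_iff₀ (hpos _)).1 (hquot s ⟨hs, hst⟩))
    ξ).trans_eq ?_
  ring

end Convolution

theorem norm_fourier_increment_le {hbar m lamb δ₀ : ℝ} {w0 : V3 → ℝ} (hhbar : 0 < hbar)
    (hm : 0 < m) (hlamb : 0 < lamb) (hδ₀ : 0 ≤ δ₀) {k : Fin 3 → ℤ} (hk : k ≠ 0)
    (h : normC lamb 1 (fun v => ∫ x, deltaW hbar m k (fun _ v' => w0 v') x v) ≤ ENNReal.ofReal δ₀)
    (ξ : V3) :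
    ‖𝓕 (fun v => (increment hbar m w0 k v : ℂ)) ξ‖
      ≤ hbar / m * (2 * Real.pi * ‖vec k‖) * δ₀ * Real.exp (-2 * Real.pi * lamb * ‖ξ‖) := by
  have hincrement (v : V3) : increment hbar m w0 k v = hbar / m * (2 * Real.pi * ‖vec k‖)
      * ∫ x, deltaW hbar m k (fun _ v' => w0 v') x v := by
    simp only [← Real.norm_of_nonneg Real.two_pi_pos.le ▸ norm_smul (2 * Real.pi) (vec k),
      ← integral_const_mul, ← increment_eq_mul_deltaW hhbar.ne' hm.ne' hk, integral_const,
      probReal_univ, one_smul]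
  have hscale : 0 ≤ hbar / m * (2 * Real.pi * ‖vec k‖) := by positivity
  simp only [hincrement, Complex.ofReal_mul _ (∫ x, deltaW _ _ _ _ x _), fourier_eq_integral_mul,
    mul_left_comm (𝐞 _ : ℂ), integral_const_mul, norm_mul, Complex.norm_of_nonneg hscale]
  rw [mul_assoc _ δ₀, ← fourier_eq_integral_mul fun v =>
    ((∫ x, deltaW hbar m k (fun _ v' => w0 v') x v : ℝ) : ℂ)]
  exact mul_le_mul_of_nonneg_left (norm_fourier_le_of_normC_le hlamb hδ₀ h ξ) hscale

theorem fourierXV_spatialMean_zero (f : T3 → V3 → ℝ) (η : V3) :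
    fourierXV (spatialMean f) 0 η = fourierXV f 0 η := by
  simp only [fourierXV, spatialMean, fourierX_zero_right, integral_const, probReal_univ, one_smul]

theorem fourierXV_spatialMean_of_ne_zero (f : T3 → V3 → ℝ) {k : Fin 3 → ℤ} (hk : k ≠ 0) (η : V3) :
    fourierXV (spatialMean f) k η = 0 := by
  simp only [fourierXV, spatialMean, fourierX_const_of_ne_zero _ hk, fourier_eq_integral_mul,
    mul_zero, integral_zero]

theorem fourierX_meanDensity {f : T3 → V3 → ℝ}
    (hf : Integrable fun p : T3 × V3 => f p.1 p.2) (k : Fin 3 → ℤ) :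
    fourierX (meanDensity f) k = fourierXV (spatialMean f) k 0 := by
  have hmean : Integrable fun p : T3 × V3 => spatialMean f p.1 p.2 :=
    hf.integral_prod_right.comp_snd _
  rw [← fourierX_density hmean]
  exact congrArg (fourierX · k) (funext fun _ => integral_integral_swap hf)

namespace IsSolution

variable {hbar m e lam lamb mu B δ₀ : ℝ} {W : T3 → ℝ} {w0 : V3 → ℝ} {wI : T3 → V3 → ℝ}
  {w : ℝ → T3 → V3 → ℝ} {k : Fin 3 → ℤ}

theorem fourierXV_zero_eq (hsol : IsSolution hbar m e W w0 wI w) (hhbar : 0 < hbar) (hm : m ≠ 0)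
    (hW : Integrable W) (hw0 : FourierInvertible fun v => (w0 v : ℂ)) (hW0 : ‖fourierX W 0‖ ≤ 1)
    {t : ℝ} (ht : 0 ≤ t) (η : V3) : fourierXV (w t) 0 η = fourierXV wI 0 η := by
  have hduhamel := hsol.duhamel hhbar hm hW hw0 hW0 ht η
  simpa [increment_zero_right, vec_zero, fourier_eq_integral_mul] using hduhamel

theorem norm_fourierXV_le (hsol : IsSolution hbar m e W w0 wI w) (hhbar : 0 < hbar) (hm : 0 < m)
    (hW : Integrable W) (hw0 : FourierInvertible fun v => (w0 v : ℂ)) (hk : k ≠ 0)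
    (hWk : ‖fourierX W k‖ ≤ 1) (hlam : 0 < lam) (hlamb : lam < lamb) (hδ₀ : 0 ≤ δ₀)
    (hsmall : 4 * |e| * δ₀ ≤ m * (lamb - lam))
    (hstab : normC lamb 1 (fun v => ∫ x, deltaW hbar m k (fun _ v' => w0 v') x v)
      ≤ ENNReal.ofReal δ₀)
    (hwI : normZ lam mu 1 0 wI ≤ ENNReal.ofReal δ₀) {t : ℝ} (ht : 0 ≤ t) (η : V3) :
    ‖fourierXV (w t) k η‖ ≤ 2 * δ₀ * decayWeight lam mu (vec k) (η + t • vec k) := by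
  have hratio : |e| / hbar * (hbar / m * (2 * Real.pi * ‖vec k‖) * δ₀)
      ≤ Real.pi * (lamb - lam) * ‖vec k‖ / 2 := by
    calc |e| / hbar * (hbar / m * (2 * Real.pi * ‖vec k‖) * δ₀)
        = 4 * |e| * δ₀ / m * (Real.pi * ‖vec k‖ / 2) := by
          field_simp
          ring
      _ ≤ (lamb - lam) * (Real.pi * ‖vec k‖ / 2) := by
          gcongr
          exact (div_le_iff₀' hm).2 hsmall
      _ = Real.pi * (lamb - lam) * ‖vec k‖ / 2 := by ring
  have hdecay := norm_le_of_volterra (Ψ := fun s ξ => fourierXV (w s) k (ξ - s • vec k))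
    (α := forcing hbar e W w k) hlam.le hlamb (by positivity) (vec_ne_zero hk) hratio
    (fun s hs ξ => hsol.duhamel hhbar hm.ne' hW hw0 hWk hs ξ)
    (fun ξ => by simpa [decayWeight] using norm_fourierXV_le_of_normZ_le hlam hδ₀ hwI k ξ)
    (norm_fourier_increment_le hhbar hm (hlam.trans hlamb) hδ₀ hk hstab)
    (fun s hs => by simpa only [sub_self] using hsol.norm_forcing_le hhbar hW hWk hs)
    (by simpa only [sub_self] using hsol.exists_norm_density_mode_le k) ht
  simpa only [add_sub_cancel_right] using hdecay (η + t • vec k)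

theorem norm_fourierXV_sub_spatialMean_le (hsol : IsSolution hbar m e W w0 wI w)
    (hhbar : 0 < hbar) (hm : 0 < m) (hW : Integrable W)
    (hw0 : FourierInvertible fun v => (w0 v : ℂ)) (hWk : ‖fourierX W k‖ ≤ 1) (hlam : 0 < lam)
    (hlamb : lam < lamb) (hδ₀ : 0 ≤ δ₀) (hsmall : 4 * |e| * δ₀ ≤ m * (lamb - lam))
    (hstab : k ≠ 0 → normC lamb 1 (fun v => ∫ x, deltaW hbar m k (fun _ v' => w0 v') x v)
      ≤ ENNReal.ofReal δ₀)
    (hwI : normZ lam mu 1 0 wI ≤ ENNReal.ofReal δ₀) {t : ℝ} (ht : 0 ≤ t) (η : V3) :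
    ‖fourierXV (w t) k η - fourierXV (spatialMean wI) k η‖
      ≤ 2 * δ₀ * decayWeight lam mu (vec k) (η + t • vec k) := by
  rcases eq_or_ne k 0 with rfl | hk
  · rw [hsol.fourierXV_zero_eq hhbar hm.ne' hW hw0 hWk ht, fourierXV_spatialMean_zero, sub_self,
      norm_zero]
    exact mul_nonneg (by positivity) (decayWeight_pos ..).le
  · rw [fourierXV_spatialMean_of_ne_zero _ hk, sub_zero]
    exact hsol.norm_fourierXV_le hhbar hm hW hw0 hk hWk hlam hlamb hδ₀ hsmall (hstab hk) hwI ht η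

end IsSolution

theorem StabilityCondition.normC_deltaW_le {hbar m lamb mub δ₀ : ℝ} {b : ℝ → ℝ → ℝ} {w0 : V3 → ℝ}
    (hst : StabilityCondition hbar m lamb mub δ₀ b w0) (hlamb : 0 ≤ lamb) (hb : 0 ≤ b 1 1)
    {k : Fin 3 → ℤ} (hk : k ≠ 0) :
    normC lamb 1 (fun v => ∫ x, deltaW hbar m k (fun _ v' => w0 v') x v) ≤ ENNReal.ofReal δ₀ :=
  (shiftedNorm_mono hlamb (le_mul_of_one_le_right hlamb (by linarith))).trans
    (hst k hk 1 1 one_pos le_rfl).1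

theorem norm_fourierX_potential_le {W n : T3 → ℝ} (hW : Integrable W) (hn : Integrable n)
    (hW0 : fourierX W 0 = 0) {k : Fin 3 → ℤ} (hWk : ‖fourierX W k‖ ≤ 1) (c : ℝ) :
    ‖fourierX (potential W n) k‖ ≤ ‖fourierX n k - fourierX (fun _ => c) k‖ := by
  rw [fourierX_potential hW hn, norm_mul]
  rcases eq_or_ne k 0 with rfl | hk
  · rw [hW0, norm_zero, zero_mul]
    exact norm_nonneg _
  · rw [fourierX_const_of_ne_zero c hk, sub_zero]
    exact mul_le_of_le_one_left (norm_nonneg _) hWk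

theorem norm_le_one_of_le_one_div_one_add_rpow {z : ℂ} {r γ : ℝ} (hr : 0 ≤ r)
    (h : ‖z‖ ≤ 1 / (1 + r ^ γ)) : ‖z‖ ≤ 1 := by
  have hpow : 0 ≤ r ^ γ := Real.rpow_nonneg hr γ
  exact h.trans ((div_le_one (by positivity)).2 (by linarith))

end QuantumLandau

theorem theorem4p1_general {hbar m e lam lamb mu δ₀ : ℝ} {W : T3 → ℝ} {w0 : V3 → ℝ}
    {wI : T3 → V3 → ℝ} {w : ℝ → T3 → V3 → ℝ} (hhbar : 0 < hbar) (hm : 0 < m) (hlam : 0 < lam)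
    (hlamb : lam < lamb) (hδ₀ : 0 ≤ δ₀) (hsmall : 4 * |e| * δ₀ ≤ m * (lamb - lam))
    (hW : Integrable W) (hW0 : fourierX W 0 = 0) (hWk : ∀ k, ‖fourierX W k‖ ≤ 1)
    (hw0 : FourierInvertible fun v => (w0 v : ℂ))
    (hwI : normZ lam mu 1 0 wI ≤ ENNReal.ofReal δ₀)
    (hstab : ∀ k, k ≠ 0 → normC lamb 1 (fun v => ∫ x, deltaW hbar m k (fun _ v' => w0 v') x v)
      ≤ ENNReal.ofReal δ₀)
    (hsol : IsSolution hbar m e W w0 wI w) {t : ℝ} (ht : 0 ≤ t) (k : Fin 3 → ℤ) (η : V3) :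
    ‖fourierXV (w t) k η - fourierXV (spatialMean wI) k η‖
        ≤ 2 * δ₀ * Real.exp (-2 * Real.pi * lam * ‖η + t • vec k‖)
          * Real.exp (-2 * Real.pi * mu * ‖vec k‖) ∧
    ‖fourierX (density (w t)) k - fourierX (meanDensity wI) k‖
        ≤ 2 * δ₀ * Real.exp (-2 * Real.pi * (lam * t + mu) * ‖vec k‖) ∧
    ‖fourierX (potential W (density (w t))) k‖
        ≤ 2 * δ₀ * Real.exp (-2 * Real.pi * lam * ‖vec k‖ * t)
          * Real.exp (-2 * Real.pi * mu * ‖vec k‖) := by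
  have hmode := hsol.norm_fourierXV_sub_spatialMean_le hhbar hm hW hw0 (hWk k) hlam hlamb hδ₀
    hsmall (hstab k) hwI ht
  have hdensity : ‖fourierX (density (w t)) k - fourierX (meanDensity wI) k‖
      ≤ 2 * δ₀ * Real.exp (-2 * Real.pi * (lam * t + mu) * ‖vec k‖) := by
    simpa only [fourierX_density (hsol.integrable t ht), fourierX_meanDensity
      hsol.integrable_initial, zero_add, decayWeight_smul_self lam mu ht] using hmode 0
  refine ⟨(hmode η).trans_eq (mul_assoc _ _ _).symm, hdensity, ?_⟩
  refine ((norm_fourierX_potential_le hW (integrable_density (hsol.integrable t ht)) hW0 (hWk k)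
    _).trans hdensity).trans_eq ?_
  rw [mul_assoc (2 * δ₀), ← Real.exp_add]
  ring_nf

theorem theorem4p1 :
    ∃ C : ℝ → ℝ → ℝ,
      ∀ (e m γ lam lamb mu mub C₀ : ℝ), 0 < m → 1 ≤ γ → 0 < lam → lam < lamb →
        0 < mu → mu < mub → 0 < C₀ →
      ∃ δs : ℝ, 0 < δs ∧
        ∀ (hbar δ₀ : ℝ), 0 < hbar → 0 < δ₀ → δ₀ ≤ δs →
        ∀ (b : ℝ → ℝ → ℝ), (∀ t τ : ℝ, 0 < τ → τ ≤ t → 0 < b t τ) →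
        ∀ (W : T3 → ℝ) (w0 : V3 → ℝ) (wI : T3 → V3 → ℝ) (w : ℝ → T3 → V3 → ℝ),
          MeasureTheory.Integrable W →
          fourierX W 0 = 0 →
          (∀ k : Fin 3 → ℤ, ‖fourierX W k‖ ≤ 1 / (1 + ‖vec k‖ ^ γ)) →
          normC lam 1 w0 ≤ ENNReal.ofReal C₀ →
          normZ lam mu 1 0 wI ≤ ENNReal.ofReal δ₀ →
          StabilityCondition hbar m lamb mub δ₀ b w0 →
          IsSolution hbar m e W w0 wI w →
          ∀ (t : ℝ), 0 ≤ t → ∀ (k : Fin 3 → ℤ) (η : V3),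
            ‖fourierXV (w t) k η - fourierXV (spatialMean wI) k η‖
                ≤ C C₀ δ₀ * Real.exp (-2 * Real.pi * lam * ‖η + t • vec k‖)
                  * Real.exp (-2 * Real.pi * mu * ‖vec k‖) ∧
            ‖fourierX (density (w t)) k - fourierX (meanDensity wI) k‖
                ≤ C C₀ δ₀ * Real.exp (-2 * Real.pi * (lam * t + mu) * ‖vec k‖) ∧
            ‖fourierX (potential W (density (w t))) k‖
                ≤ C C₀ δ₀ * Real.exp (-2 * Real.pi * lam * ‖vec k‖ * t)
                  * Real.exp (-2 * Real.pi * mu * ‖vec k‖) := by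
  refine ⟨fun _ δ₀ => 2 * δ₀, fun e m γ lam lamb mu mub C₀ hm _ hlam hlamb _ _ _ => ?_⟩
  have : 0 < lamb - lam := sub_pos.2 hlamb
  refine ⟨m * (lamb - lam) / (4 * (|e| + 1)), by positivity, ?_⟩
  intro hbar δ₀ hhbar hδ₀ hδs b hb W w0 wI w hW hW0 hWk hw0 hwI hst hsol t ht k η
  have hsmall : 4 * |e| * δ₀ ≤ m * (lamb - lam) := by
    rw [le_div_iff₀ (by positivity)] at hδs
    linarith
  exact theorem4p1_general hhbar hm hlam hlamb hδ₀.le hsmall hW hW0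
    (fun k => norm_le_one_of_le_one_div_one_add_rpow (norm_nonneg _) (hWk k))
    (fourierInvertible_of_normC_ne_top hlam (ne_top_of_le_ne_top ENNReal.ofReal_ne_top hw0)) hwI
    (fun k hk => hst.normC_deltaW_le (hlam.trans hlamb).le (hb 1 1 one_pos le_rfl).le hk) hsol ht
    k η
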